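/- Let $C^\infty(\mathbb{R}^{1|2})$ be the superalgebra of functions $f_0(x)+f_1(x)\theta_1+f_2(x)\theta_2+f_{12}(x)\theta_1\theta_2$ with smooth real coefficients, $\overline{\eta}_i=\partial_{\theta_i}-\theta_i\partial_x$, and for $F\in C^\infty(\mathbb{R}^{1|2})$ homogeneous let $X_F=F\partial_x-\frac12(-1)^{|F|}\sum_{i=1}^2\overline{\eta}_i(F)\overline{\eta}_i$ (extended linearly in $F$) be the contact vector field with generating function $F$; its brackets are $[X_F,X_G]=X_{\{F,G\}}$ with $\{F,G\}=FG'-F'G-\frac12(-1)^{|F|}\sum_i\overline{\eta}_i(F)\overline{\eta}_i(G)$, where $'=\partial_x$. Let $\mathfrak{osp}(2|2)=\mathrm{Span}(X_1,X_x,X_{x^2},X_{x\theta_1},X_{x\theta_2},X_{\theta_1},X_{\theta_2},X_{\theta_1\theta_2})$. For $\lambda,\mu\in\mathbb{R}$ let $\mathfrak{D}^2_{\lambda,\mu}$ be the superspace of differential operators $A=\sum_{\ell,m}a_{\ell,m}(x,\theta)\,\overline{\eta}_1^{\,\ell}\,\overline{\eta}_2^{\,m}$ (finite sums, $a_{\ell,m}\in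 C^\infty(\mathbb{R}^{1|2})$) from $\lambda$-densities to $\mu$-densities on $\mathbb{R}^{1|2}$, with the action $X_G\cdot A=\mathfrak{L}^\mu_{X_G}\circ A-(-1)^{|G||A|}A\circ\mathfrak{L}^\lambda_{X_G}$, where $\mathfrak{L}^\lambda_{X_G}=X_G+\lambda G'$. A differential $1$-cochain is a linear map $\Upsilon:\mathfrak{osp}(2|2)\to\mathfrak{D}^2_{\lambda,\mu}$ of the form $\Upsilon(X_G)(F)=\sum_{I,J}c_{I,J}(x,\theta)\,\overline{\eta}^{I}(G)\,\overline{\eta}^{J}(F)$ (a finite sum over $I,J\in\mathbb{N}^2$, with $c_{I,J}\in C^\infty(\mathbb{R}^{1|2})$ and $\overline{\eta}^{(\ell,m)}=\overline{\eta}_1^{\,\ell}\,\overline{\eta}_2^{\,m}$); it is a $1$-cocycle if, for homogeneous $g,h$ (and, for non-homogeneous $\Upsilon$, extending linearly from its homogeneous components), $(-1)^{|g||\Upsilon|}g\cdot\Upsilon(h)-(-1)^{|h|(|g|+|\Upsilon|)}h\cdot\Upsilon(g)-\Upsilon([g,h])=0$. The coboundary of $A\in\mathfrak{D}^2_{\lambda,\mu}$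 is $\delta A(g)=(-1)^{|g||A|}g\cdot A$. Then every differential $1$-cocycle $\Upsilon$ of $\mathfrak{osp}(2|2)$ with values in $\mathfrak{D}^2_{\lambda,\mu}$ can be written $\Upsilon=\Upsilon'+\delta A$, where $A\in\mathfrak{D}^2_{\lambda,\mu}$ and $\Upsilon'$ is a differential $1$-cocycle which is invariant with respect to $X_1=\partial_x$, that is, $X_1\cdot\Upsilon'(X_G)=\Upsilon'([X_1,X_G])$ for all $X_G\in\mathfrak{osp}(2|2)$. Equivalently, $\Upsilon'$ can be expressed with constant coefficients, that is, in the form above with all $c_{I,J}$ independent of $x$; indeed, for every differential $1$-cochain, invariance with respect to $X_1$ is equivalent to the existence of such an expression. -/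

import Mathlib

open scoped ContDiff

noncomputable section

namespace SuperContact

/-- The algebra `C^∞(ℝ)` of smooth real functions on the line. -/
def Smooth : Subalgebra ℝ (ℝ → ℝ) where
  carrier := {f | ContDiff ℝ ∞ f}
  mul_mem' := by
    intro f g hf hg
    have hf : ContDiff ℝ ∞ f := hf
    have hg : ContDiff ℝ ∞ g := hg
    exact hf.mul hg
  add_mem' := by
    intro f g hf hg
    have hf : ContDiff ℝ ∞ f := hf
    have hg : ContDiff ℝ ∞ g := hg
    exact hf.add hg
  algebraMap_mem' c := by
    change ContDiff ℝ ∞ (fun _ : ℝ => c)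
    exact contDiff_const

/-- The derivative on `C^∞(ℝ)`. -/
def Smooth.d : Smooth →ₗ[ℝ] Smooth where
  toFun f := ⟨deriv f.1, (contDiff_infty_iff_deriv.1 f.2).2⟩
  map_add' f g := Subtype.ext <| funext fun x =>
    deriv_add ((contDiff_infty_iff_deriv.1 f.2).1 x) ((contDiff_infty_iff_deriv.1 g.2).1 x)
  map_smul' c f := Subtype.ext <| funext fun x =>
    deriv_const_smul c ((contDiff_infty_iff_deriv.1 f.2).1 x)

/-- The coordinate function `x`. -/
def Smooth.x : Smooth := ⟨fun t => t, by
  change ContDiff ℝ ∞ (fun t : ℝ => t)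
  exact contDiff_id⟩

/-- `C^∞(ℝ^{1|2})`: the superfunction `f0 + f1 θ₁ + f2 θ₂ + f12 θ₁θ₂`. -/
@[ext]
structure SFun where
  f0 : Smooth
  f1 : Smooth
  f2 : Smooth
  f12 : Smooth

namespace SFun

instance : Zero SFun := ⟨⟨0, 0, 0, 0⟩⟩
instance : Add SFun := ⟨fun F G => ⟨F.f0 + G.f0, F.f1 + G.f1, F.f2 + G.f2, F.f12 + G.f12⟩⟩
instance : Neg SFun := ⟨fun F => ⟨-F.f0, -F.f1, -F.f2, -F.f12⟩⟩
instance : Sub SFun := ⟨fun F G => ⟨F.f0 - G.f0, F.f1 - G.f1, F.f2 - G.f2, F.f12 - G.f12⟩⟩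
instance : SMul ℕ SFun := ⟨fun c F => ⟨c • F.f0, c • F.f1, c • F.f2, c • F.f12⟩⟩
instance : SMul ℤ SFun := ⟨fun c F => ⟨c • F.f0, c • F.f1, c • F.f2, c • F.f12⟩⟩
instance : SMul ℝ SFun := ⟨fun c F => ⟨c • F.f0, c • F.f1, c • F.f2, c • F.f12⟩⟩

@[simp] theorem zero_f0 : (0 : SFun).f0 = 0 := rfl
@[simp] theorem zero_f1 : (0 : SFun).f1 = 0 := rfl
@[simp] theorem zero_f2 : (0 : SFun).f2 = 0 := rfl
@[simp] theorem zero_f12 : (0 : SFun).f12 = 0 := rfl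
@[simp] theorem add_f0 (F G : SFun) : (F + G).f0 = F.f0 + G.f0 := rfl
@[simp] theorem add_f1 (F G : SFun) : (F + G).f1 = F.f1 + G.f1 := rfl
@[simp] theorem add_f2 (F G : SFun) : (F + G).f2 = F.f2 + G.f2 := rfl
@[simp] theorem add_f12 (F G : SFun) : (F + G).f12 = F.f12 + G.f12 := rfl
@[simp] theorem smul_f0 (c : ℝ) (F : SFun) : (c • F).f0 = c • F.f0 := rfl
@[simp] theorem smul_f1 (c : ℝ) (F : SFun) : (c • F).f1 = c • F.f1 := rfl
@[simp] theorem smul_f2 (c : ℝ) (F : SFun) : (c • F).f2 = c • F.f2 := rfl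
@[simp] theorem smul_f12 (c : ℝ) (F : SFun) : (c • F).f12 = c • F.f12 := rfl

def toProd (F : SFun) : Smooth × Smooth × Smooth × Smooth := (F.f0, F.f1, F.f2, F.f12)

theorem toProd_injective : Function.Injective toProd := by
  intro F G h
  simp only [toProd, Prod.mk.injEq] at h
  exact SFun.ext h.1 h.2.1 h.2.2.1 h.2.2.2

instance : AddCommGroup SFun :=
  toProd_injective.addCommGroup toProd rfl (fun _ _ => rfl) (fun _ => rfl) (fun _ _ => rfl)
    (fun _ _ => rfl) (fun _ _ => rfl)

instance : Module ℝ SFun :=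
  toProd_injective.module ℝ ⟨⟨toProd, rfl⟩, fun _ _ => rfl⟩ (fun _ _ => rfl)

@[simp] theorem neg_f0 (F : SFun) : (-F).f0 = -F.f0 := rfl
@[simp] theorem neg_f1 (F : SFun) : (-F).f1 = -F.f1 := rfl
@[simp] theorem neg_f2 (F : SFun) : (-F).f2 = -F.f2 := rfl
@[simp] theorem neg_f12 (F : SFun) : (-F).f12 = -F.f12 := rfl
@[simp] theorem sub_f0 (F G : SFun) : (F - G).f0 = F.f0 - G.f0 := rfl
@[simp] theorem sub_f1 (F G : SFun) : (F - G).f1 = F.f1 - G.f1 := rfl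
@[simp] theorem sub_f2 (F G : SFun) : (F - G).f2 = F.f2 - G.f2 := rfl
@[simp] theorem sub_f12 (F G : SFun) : (F - G).f12 = F.f12 - G.f12 := rfl

/-- The supercommutative product: the `θ_i` anticommute with each other (so `θ_i² = 0`)
and commute with functions of `x`. -/
instance : Mul SFun := ⟨fun F G =>
  ⟨F.f0 * G.f0,
   F.f0 * G.f1 + F.f1 * G.f0,
   F.f0 * G.f2 + F.f2 * G.f0,
   F.f0 * G.f12 + F.f12 * G.f0 + F.f1 * G.f2 - F.f2 * G.f1⟩⟩

@[simp] theorem mul_f0 (F G : SFun) : (F * G).f0 = F.f0 * G.f0 := rfl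
@[simp] theorem mul_f1 (F G : SFun) : (F * G).f1 = F.f0 * G.f1 + F.f1 * G.f0 := rfl
@[simp] theorem mul_f2 (F G : SFun) : (F * G).f2 = F.f0 * G.f2 + F.f2 * G.f0 := rfl
@[simp] theorem mul_f12 (F G : SFun) :
    (F * G).f12 = F.f0 * G.f12 + F.f12 * G.f0 + F.f1 * G.f2 - F.f2 * G.f1 := rfl

/-- The superfunctions `1`, `x`, `θ₁`, `θ₂`. -/
def one : SFun := ⟨1, 0, 0, 0⟩
def x : SFun := ⟨Smooth.x, 0, 0, 0⟩
def θ₁ : SFun := ⟨0, 1, 0, 0⟩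
def θ₂ : SFun := ⟨0, 0, 1, 0⟩

/-- The product as a bilinear map; `mulL a` is left multiplication by `a`. -/
def mulL : SFun →ₗ[ℝ] Module.End ℝ SFun :=
  LinearMap.mk₂ ℝ (fun F G => F * G)
    (by intros; ext1 <;> simp <;> ring)
    (by intros; ext1 <;> simp [smul_sub, smul_add])
    (by intros; ext1 <;> simp <;> ring)
    (by intros; ext1 <;> simp [smul_sub, smul_add])

/-- The homogeneous component of parity `p` of a superfunction. -/
def part (p : ZMod 2) : Module.End ℝ SFun where
  toFun F := if p = 0 then ⟨F.f0, 0, 0, F.f12⟩ else ⟨0, F.f1, F.f2, 0⟩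
  map_add' F G := by split_ifs <;> ext1 <;> simp
  map_smul' c F := by split_ifs <;> ext1 <;> simp

/-- The even vector field `∂_x`. -/
def dx : Module.End ℝ SFun where
  toFun F := ⟨Smooth.d F.f0, Smooth.d F.f1, Smooth.d F.f2, Smooth.d F.f12⟩
  map_add' F G := by ext1 <;> simp
  map_smul' c F := by ext1 <;> simp

/-- The odd vector field `∂₁ = ∂/∂θ₁` (left derivative). -/
def d₁ : Module.End ℝ SFun where
  toFun F := ⟨F.f1, 0, F.f12, 0⟩
  map_add' F G := by ext1 <;> simp
  map_smul' c F := by ext1 <;> simp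

/-- The odd vector field `∂₂ = ∂/∂θ₂` (left derivative, so `∂₂(θ₁θ₂) = -θ₁`). -/
def d₂ : Module.End ℝ SFun where
  toFun F := ⟨F.f2, -F.f12, 0, 0⟩
  map_add' F G := by ext1 <;> simp [add_comm]
  map_smul' c F := by ext1 <;> simp

/-- `η̄₁ = ∂₁ - θ₁ ∂_x`. -/
def η₁ : Module.End ℝ SFun := d₁ - mulL θ₁ * dx

/-- `η̄₂ = ∂₂ - θ₂ ∂_x`. -/
def η₂ : Module.End ℝ SFun := d₂ - mulL θ₂ * dx

end SFun

open SFun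

/-- The contact vector field `X_F = F ∂_x - ½ (-1)^{|F|} ∑ᵢ η̄ᵢ(F) η̄ᵢ` (for `F` homogeneous,
extended linearly in `F`), as an operator on superfunctions. -/
def contactField : SFun →ₗ[ℝ] Module.End ℝ SFun where
  toFun F := mulL F * dx - (1 / 2 : ℝ) • ∑ p : ZMod 2, (-1 : ℝ) ^ p.val •
    (mulL (η₁ (part p F)) * η₁ + mulL (η₂ (part p F)) * η₂)
  map_add' F G := by
    simp only [map_add, add_mul, smul_add, Finset.sum_add_distrib]; abel
  map_smul' c F := by
    simp only [map_smul, smul_mul_assoc, ← smul_add, smul_comm _ c, ← Finset.smul_sum,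
      ← smul_sub, RingHom.id_apply]

/-- The Lie derivative `𝔏^λ_{X_F} = X_F + λ F'` on `λ`-densities `G α₂^λ`, which are identified
with superfunctions `G`. -/
def lieDer (lam : ℝ) : SFun →ₗ[ℝ] Module.End ℝ SFun :=
  contactField + lam • (mulL ∘ₗ dx)

/-- The contact bracket
`{F, G} = F G' - F' G - ½ (-1)^{|F|} ∑ᵢ η̄ᵢ(F) η̄ᵢ(G)` (for `F` homogeneous, extended linearly),
so that `[X_F, X_G] = X_{F, G}`. -/
def contactBracket (F G : SFun) : SFun :=
  F * dx G - dx F * G - (1 / 2 : ℝ) • ∑ p : ZMod 2, (-1 : ℝ) ^ p.val •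
    (η₁ (part p F) * η₁ G + η₂ (part p F) * η₂ G)

/-- `𝔬𝔰𝔭(2|2)`, a contact vector field `X_F` being identified with its generating function `F`:
the span of `1, x, x², xθ₁, xθ₂, θ₁, θ₂, θ₁θ₂`. -/
def osp22 : Submodule ℝ SFun :=
  Submodule.span ℝ {one, x, x * x, x * θ₁, x * θ₂, θ₁, θ₂, θ₁ * θ₂}

theorem Smooth.d_one : Smooth.d 1 = 0 :=
  Subtype.ext <| funext fun t => deriv_const t (1 : ℝ)

theorem Smooth.d_x : Smooth.d Smooth.x = 1 :=
  Subtype.ext <| funext fun t => deriv_id t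

theorem Smooth.d_mul (f g : Smooth) : Smooth.d (f * g) = Smooth.d f * g + f * Smooth.d g :=
  Subtype.ext <| funext fun t =>
    deriv_mul ((contDiff_infty_iff_deriv.1 f.2).1 t) ((contDiff_infty_iff_deriv.1 g.2).1 t)

theorem SFun.part_zero (F : SFun) : part 0 F = ⟨F.f0, 0, 0, F.f12⟩ := rfl

theorem SFun.part_one (F : SFun) : part 1 F = ⟨0, F.f1, F.f2, 0⟩ := rfl

theorem SFun.dx_apply (F : SFun) :
    dx F = ⟨Smooth.d F.f0, Smooth.d F.f1, Smooth.d F.f2, Smooth.d F.f12⟩ := rfl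

theorem SFun.η₁_apply (F : SFun) :
    η₁ F = ⟨F.f1, -Smooth.d F.f0, F.f12, -Smooth.d F.f2⟩ := by
  change (⟨F.f1, 0, F.f12, 0⟩ : SFun) - θ₁ * dx F = _
  ext1 <;> simp [θ₁, dx_apply]

theorem SFun.η₂_apply (F : SFun) :
    η₂ F = ⟨F.f2, -F.f12, -Smooth.d F.f0, Smooth.d F.f1⟩ := by
  change (⟨F.f2, -F.f12, 0, 0⟩ : SFun) - θ₂ * dx F = _
  ext1 <;> simp [θ₂, dx_apply]

theorem sum_parity {M : Type*} [AddCommMonoid M] (f : ZMod 2 → M) :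
    ∑ p : ZMod 2, f p = f 0 + f 1 := Fin.sum_univ_two f

theorem contactBracket_eq (F G : SFun) :
    contactBracket F G = F * dx G - dx F * G - (1 / 2 : ℝ) •
      ((η₁ (part 0 F) * η₁ G + η₂ (part 0 F) * η₂ G)
        - (η₁ (part 1 F) * η₁ G + η₂ (part 1 F) * η₂ G)) := by
  have h1 : ZMod.val (1 : ZMod 2) = 1 := rfl
  rw [contactBracket, sum_parity, ZMod.val_zero, h1, pow_zero, pow_one, one_smul, neg_one_smul,
    ← sub_eq_add_neg]

theorem mem_osp22 (F : SFun) : F ∈ osp22 ↔ ∃ a b c d e g h k : ℝ,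
    F = ⟨a • 1 + b • Smooth.x + c • (Smooth.x * Smooth.x), d • Smooth.x + g • 1,
      e • Smooth.x + h • 1, k • 1⟩ := by
  simp only [osp22, Submodule.mem_span_insert, Submodule.mem_span_singleton]
  constructor
  · rintro ⟨a, _, ⟨b, _, ⟨c, _, ⟨d, _, ⟨e, _, ⟨g, _, ⟨h, _, ⟨k, rfl⟩, rfl⟩, rfl⟩, rfl⟩, rfl⟩,
      rfl⟩, rfl⟩, rfl⟩
    refine ⟨a, b, c, d, e, g, h, k, ?_⟩
    ext1 <;> simp [one, x, θ₁, θ₂, add_assoc]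
  · rintro ⟨a, b, c, d, e, g, h, k, rfl⟩
    refine ⟨a, _, ⟨b, _, ⟨c, _, ⟨d, _, ⟨e, _, ⟨g, _, ⟨h, _, ⟨k, rfl⟩, rfl⟩, rfl⟩, rfl⟩, rfl⟩,
      rfl⟩, rfl⟩, ?_⟩
    ext1 <;> simp [one, x, θ₁, θ₂, add_assoc]

theorem part_mem_osp22 (p : ZMod 2) (F : osp22) : part p F.1 ∈ osp22 := by
  obtain ⟨a, b, c, d, e, g, h, k, hF⟩ := (mem_osp22 F.1).1 F.2
  rw [mem_osp22, hF]
  by_cases hp : p = 0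
  · subst hp
    exact ⟨a, b, c, 0, 0, 0, 0, k, by rw [part_zero]; simp⟩
  · have hp : p = 1 := by revert p; decide
    subst hp
    exact ⟨0, 0, 0, d, e, g, h, 0, by rw [part_one]; simp⟩

theorem contactBracket_mem_osp22 (F G : osp22) : contactBracket F.1 G.1 ∈ osp22 := by
  obtain ⟨a, b, c, d, e, g, h, k, hF⟩ := (mem_osp22 F.1).1 F.2
  obtain ⟨a', b', c', d', e', g', h', k', hG⟩ := (mem_osp22 G.1).1 G.2
  rw [mem_osp22, hF, hG, contactBracket_eq]
  simp only [part_zero, part_one, η₁_apply, η₂_apply, dx_apply, map_add, map_smul, map_zero,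
    Smooth.d_mul, Smooth.d_one, Smooth.d_x]
  refine ⟨a * b' - b * a' + (g * g' + h * h') / 2,
    2 * a * c' - 2 * c * a' + (d * g' + g * d' + e * h' + h * e') / 2,
    b * c' - c * b' + (d * d' + e * e') / 2,
    b * d' - d * b' + (d * b' + 2 * g * c' - b * d' - 2 * c * g' + k * e' - e * k') / 2,
    b * e' - e * b' + (e * b' + 2 * h * c' - b * e' - 2 * c * h' - k * d' + d * k') / 2,
    a * d' - d * a' + (g * b' - b * g' + k * h' - h * k') / 2,
    a * e' - e * a' + (h * b' - b * h' - k * g' + g * k') / 2,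
    (g * e' - h * d' - d * h' + e * g') / 2, ?_⟩
  ext1 <;> ext t <;> simp <;> ring

/-- The components of parity `p` of an element of `𝔬𝔰𝔭(2|2)`. -/
def ospPart (p : ZMod 2) : osp22 →ₗ[ℝ] osp22 :=
  ((part p).comp osp22.subtype).codRestrict osp22 (part_mem_osp22 p)

/-- The Lie superbracket of `𝔬𝔰𝔭(2|2)`. -/
def ospBracket (F G : osp22) : osp22 := ⟨contactBracket F.1 G.1, contactBracket_mem_osp22 F G⟩

/-- The element `X₁ = ∂_x` of `𝔬𝔰𝔭(2|2)`, whose generating function is `1`. -/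
def X₁ : osp22 := ⟨one, Submodule.subset_span (Set.mem_insert _ _)⟩

/-- The monomial `η̄₁^ℓ η̄₂^m`, for `I = (ℓ, m)`. -/
def ηpow (I : ℕ × ℕ) : Module.End ℝ SFun := η₁ ^ I.1 * η₂ ^ I.2

/-- The space `𝔇²_{λ,μ}` of differential operators `𝔉²_λ → 𝔉²_μ`: the finite sums
`∑ a_{ℓ,m}(x,θ) η̄₁^ℓ η̄₂^m`. As a vector space it does not depend on `λ, μ`; these only enter
the action of `𝔬𝔰𝔭(2|2)`. -/
def diffOp : Submodule ℝ (Module.End ℝ SFun) :=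
  Submodule.span ℝ (Set.range fun t : SFun × (ℕ × ℕ) => mulL t.1 * ηpow t.2)

/-- The homogeneous component of parity `q` of an operator: it sends superfunctions of parity `s`
to superfunctions of parity `s + q`. -/
def opPart (q : ZMod 2) : Module.End ℝ SFun →ₗ[ℝ] Module.End ℝ SFun where
  toFun A := ∑ s : ZMod 2, part (s + q) * A * part s
  map_add' A B := by simp only [mul_add, add_mul, Finset.sum_add_distrib]
  map_smul' c A := by
    simp only [mul_smul_comm, smul_mul_assoc, Finset.smul_sum, RingHom.id_apply]

/-- The action of contact vector fields on operators from `λ`-densities to `μ`-densities: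
`X_G · A = 𝔏^μ_{X_G} ∘ A - (-1)^{|G||A|} A ∘ 𝔏^λ_{X_G}` for `G`, `A` homogeneous, extended
bilinearly. -/
def act (lam mu : ℝ) : SFun →ₗ[ℝ] Module.End ℝ SFun →ₗ[ℝ] Module.End ℝ SFun :=
  LinearMap.mk₂ ℝ
    (fun G A => ∑ p : ZMod 2, ∑ q : ZMod 2,
      (lieDer mu (part p G) * opPart q A
        - (-1 : ℝ) ^ (p.val * q.val) • (opPart q A * lieDer lam (part p G))))
    (by intro G H A
        simp only [← Finset.sum_add_distrib]
        refine Finset.sum_congr rfl fun p _ => Finset.sum_congr rfl fun q _ => ?_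
        simp only [map_add, add_mul, mul_add, smul_add]; abel)
    (by intro c G A
        simp only [Finset.smul_sum, map_smul, smul_mul_assoc, mul_smul_comm, smul_sub,
          smul_comm c])
    (by intro G A B
        simp only [← Finset.sum_add_distrib]
        refine Finset.sum_congr rfl fun p _ => Finset.sum_congr rfl fun q _ => ?_
        simp only [map_add, add_mul, mul_add, smul_add]; abel)
    (by intro c G A
        simp only [Finset.smul_sum, map_smul, smul_mul_assoc, mul_smul_comm, smul_sub,
          smul_comm c])

/-- Linear maps from `𝔬𝔰𝔭(2|2)` to operators on superfunctions. -/
abbrev Cochain : Type := osp22 →ₗ[ℝ] Module.End ℝ SFun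

/-- The homogeneous component of parity `r` of a linear map on `𝔬𝔰𝔭(2|2)`. -/
def cochainPart (r : ZMod 2) (Υ : Cochain) : Cochain :=
  ∑ s : ZMod 2, opPart (s + r) ∘ₗ Υ ∘ₗ ospPart s

/-- The coboundary of an operator: `(δA)(X_G) = (-1)^{|G||A|} X_G · A` for `G`, `A` homogeneous,
extended bilinearly. -/
def delta₀ (lam mu : ℝ) (A : Module.End ℝ SFun) : Cochain :=
  ∑ p : ZMod 2, ∑ q : ZMod 2, (-1 : ℝ) ^ (p.val * q.val) •
    ((act lam mu).flip (opPart q A) ∘ₗ osp22.subtype ∘ₗ ospPart p)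

/-- The coboundary of a linear map `Υ` on `𝔬𝔰𝔭(2|2)`:
`(δΥ)(g, h) = (-1)^{|g||Υ|} g · Υ(h) - (-1)^{|h|(|g|+|Υ|)} h · Υ(g) - Υ([g, h])`
for `g`, `h`, `Υ` homogeneous, extended linearly in each. -/
def delta₁ (lam mu : ℝ) (Υ : Cochain) (G H : osp22) : Module.End ℝ SFun :=
  ∑ p : ZMod 2, ∑ q : ZMod 2, ∑ r : ZMod 2,
    ((-1 : ℝ) ^ (p.val * r.val) • act lam mu (ospPart p G) (cochainPart r Υ (ospPart q H))
      - (-1 : ℝ) ^ (q.val * (p.val + r.val)) •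
        act lam mu (ospPart q H) (cochainPart r Υ (ospPart p G))
      - cochainPart r Υ (ospBracket (ospPart p G) (ospPart q H)))

/-- `Υ(X_G)(F) = ∑ c_{I,J}(x,θ) η̄^I(G) η̄^J(F)` for all `G` in `𝔬𝔰𝔭(2|2)` and all `F`, a finite sum
with coefficients `c_{I,J} = c (I, J)`. -/
def HasExpression (Υ : Cochain) (c : (ℕ × ℕ) × (ℕ × ℕ) →₀ SFun) : Prop :=
  ∀ (G : osp22) (F : SFun), Υ G F = c.sum fun I a => a * ηpow I.1 G.1 * ηpow I.2 F

/-- Differential `1`-cochains of `𝔬𝔰𝔭(2|2)` with values in `𝔇²_{λ,μ}`. -/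
def IsDiffCochain (Υ : Cochain) : Prop :=
  (∀ G, Υ G ∈ diffOp) ∧ ∃ c, HasExpression Υ c

/-- Differential `1`-cocycles of `𝔬𝔰𝔭(2|2)` with values in `𝔇²_{λ,μ}`. -/
def IsDiffCocycle (lam mu : ℝ) (Υ : Cochain) : Prop :=
  IsDiffCochain Υ ∧ ∀ G H, delta₁ lam mu Υ G H = 0

/-- Invariance with respect to `X₁ = ∂_x`: `X₁ · Υ(X_G) = Υ([X₁, X_G])`. -/
def IsX₁Invariant (lam mu : ℝ) (Υ : Cochain) : Prop :=
  ∀ G, act lam mu X₁ (Υ G) = Υ (ospBracket X₁ G)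

/-- `Υ` can be written with constant coefficients, that is, with coefficients which do not depend
on `x` (they lie in the Grassmann algebra generated by `θ₁`, `θ₂`). -/
def HasConstantCoefficients (Υ : Cochain) : Prop :=
  ∃ c, HasExpression Υ c ∧ ∀ I, dx (c I) = 0

end SuperContact

end

noncomputable section
namespace SuperContact
open SFun

/-! The field `X₁` acts on operators by `[∂_x, ·]`, whatever λ and μ are. Since `∂_x` commutes with
both `η̄ᵢ`, this bracket merely differentiates the coefficients of a differential operator, so it is
surjective on `diffOp`: integrate the coefficients (`exists_commutator_eq`). Choosing `A` with
`[∂_x, A] = Υ(X₁)` makes `Υ - δA` vanish on `X₁`. It is still a cocycle because δδ = 0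
(`delta₁_delta₀`, from the representation property `act_contactBracket`), and still differential
because `δA` is bidifferential (`isDiffCochain_delta₀`). The cocycle identity with `g = X₁` is then
exactly invariance (`isX₁Invariant_of_cocycle`).

Constant coefficients imply invariance by the Leibniz rule for `∂_x` (`bidiffOps_dx`). Conversely,
an operator commuting with `∂_x` has coefficients independent of `x` (`mem_ops_ker_dx_of_commute`):
it agrees with its coefficients frozen at 0 on polynomials, and polynomials approximate any function
to finite order at any point. For invariant `Υ`, the values on `1, x, x²` and on `θᵢ, xθᵢ`,
corrected by multiples of `x`, as well as the value on `θ₁θ₂`, commute with `∂_x`; they are the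
constant coefficients of an expression for `Υ` in derivatives of `G`. -/

/-! ### Commutation relations between multiplications, `∂_x` and `η̄ᵢ`. -/

theorem SFun.mulL_one : mulL one = 1 := by
  refine LinearMap.ext fun F => ?_
  change one * F = F
  ext1 <;> simp [one]

theorem SFun.mul_assoc' (a b c : SFun) : a * b * c = a * (b * c) := by
  ext1 <;> simp <;> ring

theorem SFun.mulL_mul (a b : SFun) : mulL (a * b) = mulL a * mulL b :=
  LinearMap.ext fun F => mul_assoc' a b F

/-- The parity involution. -/
def parityInv : Module.End ℝ SFun := part 0 - part 1

theorem parityInv_apply (F : SFun) : parityInv F = ⟨F.f0, -F.f1, -F.f2, F.f12⟩ := by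
  change part 0 F - part 1 F = _
  rw [part_zero, part_one]
  ext1 <;> simp

theorem d₁_apply (F : SFun) : d₁ F = ⟨F.f1, 0, F.f12, 0⟩ := rfl

theorem d₂_apply (F : SFun) : d₂ F = ⟨F.f2, -F.f12, 0, 0⟩ := rfl

theorem η₁_mul (F G : SFun) : η₁ (F * G) = η₁ F * G + parityInv F * η₁ G := by
  simp only [η₁_apply, parityInv_apply]
  ext1 <;> simp [Smooth.d_mul] <;> ring

theorem η₂_mul (F G : SFun) : η₂ (F * G) = η₂ F * G + parityInv F * η₂ G := by
  simp only [η₂_apply, parityInv_apply]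
  ext1 <;> simp [Smooth.d_mul] <;> ring

theorem dx_mul (F G : SFun) : dx (F * G) = dx F * G + F * dx G := by
  simp only [dx_apply]
  ext1 <;> simp [Smooth.d_mul] <;> ring

theorem η₁_comp_mulL (a : SFun) : η₁ * mulL a = mulL (η₁ a) + mulL (parityInv a) * η₁ :=
  LinearMap.ext fun F => η₁_mul a F

theorem η₂_comp_mulL (a : SFun) : η₂ * mulL a = mulL (η₂ a) + mulL (parityInv a) * η₂ :=
  LinearMap.ext fun F => η₂_mul a F

theorem dx_comp_mulL (a : SFun) : dx * mulL a = mulL (dx a) + mulL a * dx :=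
  LinearMap.ext fun F => dx_mul a F

theorem η₁_sq : η₁ * η₁ = -dx := by
  refine LinearMap.ext fun F => ?_
  change η₁ (η₁ F) = - dx F
  simp only [η₁_apply, dx_apply]
  ext1 <;> simp

theorem η₂_mul_η₁ : η₂ * η₁ = -(η₁ * η₂) := by
  refine LinearMap.ext fun F => ?_
  change η₂ (η₁ F) = - η₁ (η₂ F)
  simp only [η₁_apply, η₂_apply]
  ext1 <;> simp

theorem commute_dx_η₁ : Commute dx η₁ := by
  refine LinearMap.ext fun F => ?_
  change dx (η₁ F) = η₁ (dx F)
  simp only [η₁_apply, dx_apply]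
  ext1 <;> simp

theorem commute_dx_η₂ : Commute dx η₂ := by
  refine LinearMap.ext fun F => ?_
  change dx (η₂ F) = η₂ (dx F)
  simp only [η₂_apply, dx_apply]
  ext1 <;> simp

theorem commute_dx_ηpow (I : ℕ × ℕ) : Commute dx (ηpow I) :=
  (commute_dx_η₁.pow_right _).mul_right (commute_dx_η₂.pow_right _)

theorem ηpow_zero : ηpow (0, 0) = 1 := by simp [ηpow]

theorem η₁_mul_ηpow (I : ℕ × ℕ) : η₁ * ηpow I = ηpow (I.1 + 1, I.2) := by
  simp only [ηpow, pow_succ', mul_assoc]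

theorem η₂_mul_η₁_pow (n : ℕ) : η₂ * η₁ ^ n = (-1 : ℝ) ^ n • (η₁ ^ n * η₂) := by
  induction n with
  | zero => simp
  | succ n ih =>
    rw [pow_succ' η₁, ← mul_assoc, η₂_mul_η₁, neg_mul, mul_assoc, ih, pow_succ', mul_smul_comm,
      mul_smul, neg_one_smul, mul_assoc]

theorem η₂_mul_ηpow (I : ℕ × ℕ) : η₂ * ηpow I = (-1 : ℝ) ^ I.1 • ηpow (I.1, I.2 + 1) := by
  simp only [ηpow, ← mul_assoc, η₂_mul_η₁_pow, smul_mul_assoc]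
  rw [mul_assoc, ← pow_succ']

/-! ### Algebras of differential operators with restricted coefficients. -/

/-- A space of coefficients stable under the product, the derivations and the parity. -/
structure IsCoeffSpace (S : Submodule ℝ SFun) : Prop where
  one_mem : one ∈ S
  θ₁_mem : θ₁ ∈ S
  θ₂_mem : θ₂ ∈ S
  mul_mem : ∀ {a b}, a ∈ S → b ∈ S → a * b ∈ S
  η₁_mem : ∀ {a}, a ∈ S → η₁ a ∈ S
  η₂_mem : ∀ {a}, a ∈ S → η₂ a ∈ S
  part_mem : ∀ p {a}, a ∈ S → part p a ∈ S

theorem isCoeffSpace_top : IsCoeffSpace ⊤ := by constructor <;> intros <;> trivial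

theorem isCoeffSpace_ker_dx : IsCoeffSpace (LinearMap.ker dx) where
  one_mem := by
    rw [LinearMap.mem_ker, dx_apply]; ext1 <;> simp [one, Smooth.d_one]
  θ₁_mem := by
    rw [LinearMap.mem_ker, dx_apply]; ext1 <;> simp [θ₁, Smooth.d_one]
  θ₂_mem := by
    rw [LinearMap.mem_ker, dx_apply]; ext1 <;> simp [θ₂, Smooth.d_one]
  mul_mem {a b} ha hb := by
    rw [LinearMap.mem_ker] at *
    rw [dx_mul, ha, hb]; ext1 <;> simp
  η₁_mem {a} ha := by
    rw [LinearMap.mem_ker] at *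
    have := LinearMap.congr_fun commute_dx_η₁ a
    simp only [Module.End.mul_apply, ha, map_zero] at this
    exact this
  η₂_mem {a} ha := by
    rw [LinearMap.mem_ker] at *
    have := LinearMap.congr_fun commute_dx_η₂ a
    simp only [Module.End.mul_apply, ha, map_zero] at this
    exact this
  part_mem p {a} ha := by
    rw [LinearMap.mem_ker, dx_apply] at *
    have h0 := congrArg SFun.f0 ha
    have h1 := congrArg SFun.f1 ha
    have h2 := congrArg SFun.f2 ha
    have h12 := congrArg SFun.f12 ha
    simp only [zero_f0, zero_f1, zero_f2, zero_f12] at h0 h1 h2 h12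
    by_cases hp : p = 0
    · subst hp; rw [part_zero]; ext1 <;> simp [h0, h12]
    · have hp : p = 1 := by revert p; decide
      subst hp; rw [part_one]; ext1 <;> simp [h1, h2]

theorem IsCoeffSpace.parityInv_mem {S : Submodule ℝ SFun} (hS : IsCoeffSpace S) {a : SFun}
    (ha : a ∈ S) : parityInv a ∈ S := S.sub_mem (hS.part_mem 0 ha) (hS.part_mem 1 ha)

/-- The differential operators with coefficients in `S`. -/
def opsSpan (S : Submodule ℝ SFun) : Submodule ℝ (Module.End ℝ SFun) :=
  Submodule.span ℝ {A | ∃ a ∈ S, ∃ I, A = mulL a * ηpow I}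

/-- The algebra of operators generated by the multiplications by elements of `S`, `η̄₁`, `η̄₂`. -/
def ops (S : Submodule ℝ SFun) : Subalgebra ℝ (Module.End ℝ SFun) :=
  Algebra.adjoin ℝ ({A | ∃ a ∈ S, A = mulL a} ∪ {η₁, η₂})

section ops
variable {S : Submodule ℝ SFun}

theorem mulL_mem_ops {a : SFun} (ha : a ∈ S) : mulL a ∈ ops S :=
  Algebra.subset_adjoin (Or.inl ⟨a, ha, rfl⟩)

theorem η₁_mem_ops : η₁ ∈ ops S := Algebra.subset_adjoin (Or.inr (Or.inl rfl))

theorem η₂_mem_ops : η₂ ∈ ops S := Algebra.subset_adjoin (Or.inr (Or.inr rfl))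

theorem ops_mono {S' : Submodule ℝ SFun} (h : S ≤ S') : ops S ≤ ops S' :=
  Algebra.adjoin_mono (Set.union_subset_union_left _ (by
    rintro _ ⟨a, ha, rfl⟩; exact ⟨a, h ha, rfl⟩))

theorem dx_mem_ops : dx ∈ ops S := by
  have h : dx = -(η₁ * η₁) := by rw [η₁_sq, neg_neg]
  rw [h]
  exact neg_mem (mul_mem η₁_mem_ops η₁_mem_ops)

theorem ηpow_mem_ops (I : ℕ × ℕ) : ηpow I ∈ ops S :=
  mul_mem (pow_mem η₁_mem_ops _) (pow_mem η₂_mem_ops _)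

theorem d₁_mem_ops (hS : IsCoeffSpace S) : d₁ ∈ ops S := by
  have h : d₁ = η₁ + mulL θ₁ * dx := by rw [η₁]; abel
  rw [h]
  exact add_mem η₁_mem_ops (mul_mem (mulL_mem_ops hS.θ₁_mem) dx_mem_ops)

theorem d₂_mem_ops (hS : IsCoeffSpace S) : d₂ ∈ ops S := by
  have h : d₂ = η₂ + mulL θ₂ * dx := by rw [η₂]; abel
  rw [h]
  exact add_mem η₂_mem_ops (mul_mem (mulL_mem_ops hS.θ₂_mem) dx_mem_ops)

/-- The projection `f₀ + f₁θ₁ + f₂θ₂ + f₁₂θ₁θ₂ ↦ f₀`. -/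
def body : Module.End ℝ SFun := (1 - mulL θ₁ * d₁) * (1 - mulL θ₂ * d₂)

theorem body_apply (F : SFun) : body F = ⟨F.f0, 0, 0, 0⟩ := by
  change (F - θ₂ * d₂ F) - θ₁ * d₁ (F - θ₂ * d₂ F) = _
  simp only [d₁_apply, d₂_apply, θ₁, θ₂]
  ext1 <;> simp

theorem body_mem_ops (hS : IsCoeffSpace S) : body ∈ ops S :=
  mul_mem (sub_mem (one_mem _) (mul_mem (mulL_mem_ops hS.θ₁_mem) (d₁_mem_ops hS)))
    (sub_mem (one_mem _) (mul_mem (mulL_mem_ops hS.θ₂_mem) (d₂_mem_ops hS)))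

/-- Parity projections are themselves differential operators with Grassmann coefficients: `body *
dᵢ` extracts `fᵢ`, and multiplying by `θᵢ` puts it back. Hence parity signs never lead out of `ops
S`. -/
theorem part_mem_ops (hS : IsCoeffSpace S) (p : ZMod 2) : part p ∈ ops S := by
  have h1 : part 1 = mulL θ₁ * body * d₁ + mulL θ₂ * body * d₂ := by
    refine LinearMap.ext fun F => ?_
    change part 1 F = θ₁ * body (d₁ F) + θ₂ * body (d₂ F)
    simp only [body_apply, d₁_apply, d₂_apply, part_one, θ₁, θ₂]
    ext1 <;> simp
  have h0 : part 0 = 1 - part 1 := by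
    refine LinearMap.ext fun F => ?_
    change part 0 F = F - part 1 F
    rw [part_zero, part_one]
    ext1 <;> simp
  have hm1 : part 1 ∈ ops S := by
    rw [h1]
    exact add_mem
      (mul_mem (mul_mem (mulL_mem_ops hS.θ₁_mem) (body_mem_ops hS)) (d₁_mem_ops hS))
      (mul_mem (mul_mem (mulL_mem_ops hS.θ₂_mem) (body_mem_ops hS)) (d₂_mem_ops hS))
  by_cases hp : p = 0
  · subst hp; rw [h0]; exact sub_mem (one_mem _) hm1
  · have hp : p = 1 := by revert p; decide
    subst hp; exact hm1

theorem parityInv_mem_ops (hS : IsCoeffSpace S) : parityInv ∈ ops S :=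
  sub_mem (part_mem_ops hS 0) (part_mem_ops hS 1)

theorem opPart_mem_ops (hS : IsCoeffSpace S) (q : ZMod 2) {A : Module.End ℝ SFun}
    (hA : A ∈ ops S) : opPart q A ∈ ops S := by
  change ∑ s : ZMod 2, part (s + q) * A * part s ∈ ops S
  exact sum_mem fun s _ =>
    mul_mem (mul_mem (part_mem_ops hS (s + q)) hA) (part_mem_ops hS s)

theorem opsSpan_le_ops : opsSpan S ≤ Subalgebra.toSubmodule (ops S) := by
  refine Submodule.span_le.2 ?_
  rintro _ ⟨a, ha, I, rfl⟩
  exact (ops S).mul_mem (mulL_mem_ops ha) (ηpow_mem_ops I)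

theorem mulL_mul_mem_opsSpan (hS : IsCoeffSpace S) {a : SFun} (ha : a ∈ S)
    {A : Module.End ℝ SFun} (hA : A ∈ opsSpan S) : mulL a * A ∈ opsSpan S := by
  induction hA using Submodule.span_induction with
  | mem A h =>
    obtain ⟨b, hb, I, rfl⟩ := h
    refine Submodule.subset_span ⟨a * b, hS.mul_mem ha hb, I, ?_⟩
    rw [mulL_mul, mul_assoc]
  | zero => simp
  | add A B _ _ hA hB => rw [mul_add]; exact add_mem hA hB
  | smul c A _ hA => rw [mul_smul_comm]; exact Submodule.smul_mem _ _ hA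

theorem η₁_mul_mem_opsSpan (hS : IsCoeffSpace S)
    {A : Module.End ℝ SFun} (hA : A ∈ opsSpan S) : η₁ * A ∈ opsSpan S := by
  induction hA using Submodule.span_induction with
  | mem A h =>
    obtain ⟨b, hb, I, rfl⟩ := h
    rw [← mul_assoc, η₁_comp_mulL, add_mul, mul_assoc, η₁_mul_ηpow]
    exact add_mem (Submodule.subset_span ⟨_, hS.η₁_mem hb, I, rfl⟩)
      (Submodule.subset_span ⟨_, hS.parityInv_mem hb, _, rfl⟩)
  | zero => simp
  | add A B _ _ hA hB => rw [mul_add]; exact add_mem hA hB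
  | smul c A _ hA => rw [mul_smul_comm]; exact Submodule.smul_mem _ _ hA

theorem η₂_mul_mem_opsSpan (hS : IsCoeffSpace S)
    {A : Module.End ℝ SFun} (hA : A ∈ opsSpan S) : η₂ * A ∈ opsSpan S := by
  induction hA using Submodule.span_induction with
  | mem A h =>
    obtain ⟨b, hb, I, rfl⟩ := h
    rw [← mul_assoc, η₂_comp_mulL, add_mul, mul_assoc, η₂_mul_ηpow, mul_smul_comm]
    exact add_mem (Submodule.subset_span ⟨_, hS.η₂_mem hb, I, rfl⟩)
      (Submodule.smul_mem _ _ (Submodule.subset_span ⟨_, hS.parityInv_mem hb, _, rfl⟩))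
  | zero => simp
  | add A B _ _ hA hB => rw [mul_add]; exact add_mem hA hB
  | smul c A _ hA => rw [mul_smul_comm]; exact Submodule.smul_mem _ _ hA

/-- A space of operators stable under left multiplication by the generators of `ops S` is stable
under left multiplication by `ops S`. -/
theorem ops_mul_mem {V : Type*} [AddCommGroup V] [Module ℝ V] [Module (Module.End ℝ SFun) V]
    [IsScalarTower ℝ (Module.End ℝ SFun) V] (M : Submodule ℝ V)
    (hm : ∀ a ∈ S, ∀ v ∈ M, mulL a • v ∈ M) (h1 : ∀ v ∈ M, η₁ • v ∈ M) (h2 : ∀ v ∈ M, η₂ • v ∈ M)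
    {A : Module.End ℝ SFun} (hA : A ∈ ops S) : ∀ v ∈ M, A • v ∈ M := by
  induction hA using Algebra.adjoin_induction with
  | mem A h =>
    rcases h with ⟨a, ha, rfl⟩ | rfl | rfl
    · exact hm a ha
    · exact h1
    · exact h2
  | algebraMap r => intro v hv; rw [algebraMap_smul]; exact M.smul_mem _ hv
  | add A B _ _ hA hB => intro v hv; rw [add_smul]; exact M.add_mem (hA v hv) (hB v hv)
  | mul A B _ _ hA hB => intro v hv; rw [mul_smul]; exact hA _ (hB v hv)

/-- Normal ordering: the span contains the identity and is stable under left multiplication by the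
generators, so every word in them lies in it. -/
theorem ops_le_opsSpan (hS : IsCoeffSpace S) : Subalgebra.toSubmodule (ops S) ≤ opsSpan S := by
  intro A hA
  have h := ops_mul_mem (S := S) (opsSpan S) (fun a ha v hv => mulL_mul_mem_opsSpan hS ha hv)
    (fun v hv => η₁_mul_mem_opsSpan hS hv) (fun v hv => η₂_mul_mem_opsSpan hS hv) hA 1
    (Submodule.subset_span ⟨one, hS.one_mem, (0, 0), by rw [mulL_one, ηpow_zero, one_mul]⟩)
  simpa using h

theorem mem_ops_iff (hS : IsCoeffSpace S) {A : Module.End ℝ SFun} :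
    A ∈ ops S ↔ A ∈ opsSpan S :=
  ⟨fun h => ops_le_opsSpan hS h, fun h => opsSpan_le_ops h⟩

end ops

theorem mem_diffOp_iff {A : Module.End ℝ SFun} : A ∈ diffOp ↔ A ∈ ops ⊤ := by
  rw [mem_ops_iff isCoeffSpace_top, diffOp, opsSpan]
  have : (Set.range fun t : SFun × (ℕ × ℕ) => mulL t.1 * ηpow t.2) =
      {A | ∃ a ∈ (⊤ : Submodule ℝ SFun), ∃ I, A = mulL a * ηpow I} := by
    ext A
    constructor
    · rintro ⟨⟨a, I⟩, rfl⟩; exact ⟨a, trivial, I, rfl⟩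
    · rintro ⟨a, -, I, rfl⟩; exact ⟨⟨a, I⟩, rfl⟩
  rw [this]

/-! ### Bidifferential operators and their closure properties. -/

/-- The bilinear operator `(G, F) ↦ P(G) Q(F)`. -/
def prodOp (P Q : Module.End ℝ SFun) : SFun →ₗ[ℝ] Module.End ℝ SFun :=
  LinearMap.mulRight ℝ Q ∘ₗ mulL ∘ₗ P

theorem prodOp_apply (P Q : Module.End ℝ SFun) (G : SFun) : prodOp P Q G = mulL (P G) * Q := rfl

theorem prodOp_ext {T T' : SFun →ₗ[ℝ] Module.End ℝ SFun} (h : ∀ G F, T G F = T' G F) : T = T' :=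
  LinearMap.ext fun G => LinearMap.ext fun F => h G F

/-- The bidifferential operators with coefficients in `S`. -/
def bidiffOps (S : Submodule ℝ SFun) : Submodule ℝ (SFun →ₗ[ℝ] Module.End ℝ SFun) :=
  Submodule.span ℝ {T | ∃ a ∈ S, ∃ I J, T = prodOp (mulL a * ηpow I) (ηpow J)}

section bidiffOps
variable {S : Submodule ℝ SFun}

theorem prodOp_add_left (P P' Q : Module.End ℝ SFun) :
    prodOp (P + P') Q = prodOp P Q + prodOp P' Q :=
  LinearMap.ext fun G => by simp [prodOp_apply, add_mul]

theorem prodOp_add_right (P Q Q' : Module.End ℝ SFun) :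
    prodOp P (Q + Q') = prodOp P Q + prodOp P Q' :=
  LinearMap.ext fun G => by simp [prodOp_apply, mul_add]

theorem prodOp_smul_left (c : ℝ) (P Q : Module.End ℝ SFun) :
    prodOp (c • P) Q = c • prodOp P Q :=
  LinearMap.ext fun G => by simp [prodOp_apply]

theorem prodOp_smul_right (c : ℝ) (P Q : Module.End ℝ SFun) :
    prodOp P (c • Q) = c • prodOp P Q :=
  LinearMap.ext fun G => by simp [prodOp_apply]

theorem prodOp_zero_left (Q : Module.End ℝ SFun) : prodOp 0 Q = 0 :=
  LinearMap.ext fun G => by simp [prodOp_apply]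

theorem prodOp_zero_right (P : Module.End ℝ SFun) : prodOp P 0 = 0 :=
  LinearMap.ext fun G => by simp [prodOp_apply]

theorem prodOp_ηpow_mem (hS : IsCoeffSpace S) {P : Module.End ℝ SFun} (hP : P ∈ ops S)
    (J : ℕ × ℕ) : prodOp P (ηpow J) ∈ bidiffOps S := by
  rw [mem_ops_iff hS] at hP
  induction hP using Submodule.span_induction with
  | mem A h => obtain ⟨a, ha, I, rfl⟩ := h; exact Submodule.subset_span ⟨a, ha, I, J, rfl⟩
  | zero => rw [prodOp_zero_left]; exact zero_mem _
  | add A B _ _ hA hB => rw [prodOp_add_left]; exact add_mem hA hB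
  | smul c A _ hA => rw [prodOp_smul_left]; exact Submodule.smul_mem _ _ hA

/-- Supercommutativity moves the coefficient `b` to the left of `P(G)`; its odd part picks up the
parity involution on `P(G)`. -/
theorem prodOp_mulL_right (P Q : Module.End ℝ SFun) (b : SFun) :
    prodOp P (mulL b * Q) =
      prodOp (mulL (part 0 b) * P + mulL (part 1 b) * (parityInv * P)) Q := by
  refine prodOp_ext fun G F => ?_
  change P G * (b * Q F) = (part 0 b * P G + part 1 b * parityInv (P G)) * Q F
  rw [← mul_assoc', part_zero, part_one, parityInv_apply]
  congr 1
  ext1 <;> simp <;> ring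

theorem prodOp_mem (hS : IsCoeffSpace S) {P Q : Module.End ℝ SFun} (hP : P ∈ ops S)
    (hQ : Q ∈ ops S) : prodOp P Q ∈ bidiffOps S := by
  rw [mem_ops_iff hS] at hQ
  induction hQ using Submodule.span_induction with
  | mem A h =>
    obtain ⟨b, hb, J, rfl⟩ := h
    rw [prodOp_mulL_right]
    exact prodOp_ηpow_mem hS (add_mem (mul_mem (mulL_mem_ops (hS.part_mem 0 hb)) hP)
      (mul_mem (mulL_mem_ops (hS.part_mem 1 hb)) (mul_mem (parityInv_mem_ops hS) hP))) J
  | zero => rw [prodOp_zero_right]; exact zero_mem _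
  | add A B _ _ hA hB => rw [prodOp_add_right]; exact add_mem hA hB
  | smul c A _ hA => rw [prodOp_smul_right]; exact Submodule.smul_mem _ _ hA

theorem bidiffOps_induction
    {p : (SFun →ₗ[ℝ] Module.End ℝ SFun) → Prop}
    (hprod : ∀ P ∈ ops S, ∀ Q ∈ ops S, p (prodOp P Q)) (h0 : p 0)
    (hadd : ∀ T T', p T → p T' → p (T + T')) (hsmul : ∀ (c : ℝ) T, p T → p (c • T))
    {T : SFun →ₗ[ℝ] Module.End ℝ SFun} (hT : T ∈ bidiffOps S) : p T := by
  induction hT using Submodule.span_induction with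
  | mem A h =>
    obtain ⟨b, hb, I, J, rfl⟩ := h
    exact hprod _ (mul_mem (mulL_mem_ops hb) (ηpow_mem_ops I)) _ (ηpow_mem_ops J)
  | zero => exact h0
  | add A B _ _ hA hB => exact hadd _ _ hA hB
  | smul c A _ hA => exact hsmul _ _ hA

theorem bidiffOps_comp_left (hS : IsCoeffSpace S) {P : Module.End ℝ SFun} (hP : P ∈ ops S)
    {T : SFun →ₗ[ℝ] Module.End ℝ SFun} (hT : T ∈ bidiffOps S) : T ∘ₗ P ∈ bidiffOps S :=
  bidiffOps_induction (p := fun T => T ∘ₗ P ∈ bidiffOps S)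
    (fun _ hP' _ hQ => prodOp_mem hS (mul_mem hP' hP) hQ) (by simp)
    (fun T T' h h' => by rw [LinearMap.add_comp]; exact add_mem h h')
    (fun c T h => by rw [LinearMap.smul_comp]; exact Submodule.smul_mem _ _ h) hT

theorem bidiffOps_mul_right (hS : IsCoeffSpace S) {Q : Module.End ℝ SFun} (hQ : Q ∈ ops S)
    {T : SFun →ₗ[ℝ] Module.End ℝ SFun} (hT : T ∈ bidiffOps S) :
    LinearMap.mulRight ℝ Q ∘ₗ T ∈ bidiffOps S :=
  bidiffOps_induction (p := fun T => LinearMap.mulRight ℝ Q ∘ₗ T ∈ bidiffOps S)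
    (fun _ hP' _ hQ' => prodOp_mem hS hP' (mul_mem hQ' hQ)) (by simp)
    (fun T T' h h' => by rw [LinearMap.comp_add]; exact add_mem h h')
    (fun c T h => by rw [LinearMap.comp_smul]; exact Submodule.smul_mem _ _ h) hT

/-- It suffices to treat generators of `ops S`. For `η̄ᵢ` the super Leibniz rule splits `η̄ᵢ(P(G)
Q(F))` into two products of the same kind. -/
theorem bidiffOps_smul (hS : IsCoeffSpace S) {A : Module.End ℝ SFun} (hA : A ∈ ops S)
    {T : SFun →ₗ[ℝ] Module.End ℝ SFun} (hT : T ∈ bidiffOps S) : A • T ∈ bidiffOps S := by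
  refine ops_mul_mem (S := S) (bidiffOps S) (fun a ha T hT => ?_) (fun T hT => ?_)
    (fun T hT => ?_) hA T hT
  · refine bidiffOps_induction (p := fun T => mulL a • T ∈ bidiffOps S)
      (fun P hP Q hQ => ?_) (by simp) (fun T T' h h' => by rw [smul_add]; exact add_mem h h')
      (fun c T h => by rw [smul_comm]; exact Submodule.smul_mem _ _ h) hT
    have : mulL a • prodOp P Q = prodOp (mulL a * P) Q :=
      prodOp_ext fun G F => (mul_assoc' a (P G) (Q F)).symm
    rw [this]
    exact prodOp_mem hS (mul_mem (mulL_mem_ops ha) hP) hQ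
  · refine bidiffOps_induction (p := fun T => η₁ • T ∈ bidiffOps S)
      (fun P hP Q hQ => ?_) (by simp) (fun T T' h h' => by rw [smul_add]; exact add_mem h h')
      (fun c T h => by rw [smul_comm]; exact Submodule.smul_mem _ _ h) hT
    have : η₁ • prodOp P Q = prodOp (η₁ * P) Q + prodOp (parityInv * P) (η₁ * Q) :=
      prodOp_ext fun G F => η₁_mul (P G) (Q F)
    rw [this]
    exact add_mem (prodOp_mem hS (mul_mem η₁_mem_ops hP) hQ)
      (prodOp_mem hS (mul_mem (parityInv_mem_ops hS) hP) (mul_mem η₁_mem_ops hQ))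
  · refine bidiffOps_induction (p := fun T => η₂ • T ∈ bidiffOps S)
      (fun P hP Q hQ => ?_) (by simp) (fun T T' h h' => by rw [smul_add]; exact add_mem h h')
      (fun c T h => by rw [smul_comm]; exact Submodule.smul_mem _ _ h) hT
    have : η₂ • prodOp P Q = prodOp (η₂ * P) Q + prodOp (parityInv * P) (η₂ * Q) :=
      prodOp_ext fun G F => η₂_mul (P G) (Q F)
    rw [this]
    exact add_mem (prodOp_mem hS (mul_mem η₂_mem_ops hP) hQ)
      (prodOp_mem hS (mul_mem (parityInv_mem_ops hS) hP) (mul_mem η₂_mem_ops hQ))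

theorem bidiffOps_apply_mem {T : SFun →ₗ[ℝ] Module.End ℝ SFun}
    (hT : T ∈ bidiffOps S) (G : SFun) : T G ∈ ops (⊤ : Submodule ℝ SFun) :=
  bidiffOps_induction (p := fun T => T G ∈ ops (⊤ : Submodule ℝ SFun))
    (fun _ _ _ hQ => mul_mem (mulL_mem_ops trivial)
      (ops_mono le_top hQ))
    (zero_mem _) (fun _ _ h h' => add_mem h h')
    (fun c _ h => Subalgebra.smul_mem _ h c) hT

/-- Taking `S = ⊤` gives arbitrary expressions and `S = ker dx` those with constant coefficients.
The operator `T` lives on all superfunctions, so it can be composed freely before restriction to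
`osp22`. -/
theorem exists_expression_iff (Υ : Cochain) :
    (∃ c, HasExpression Υ c ∧ ∀ I, c I ∈ S) ↔
      ∃ T ∈ bidiffOps S, Υ = T ∘ₗ osp22.subtype := by
  constructor
  · rintro ⟨c, hc, hS⟩
    refine ⟨c.sum fun I a => prodOp (mulL a * ηpow I.1) (ηpow I.2),
      sum_mem fun I _ => Submodule.subset_span ⟨c I, hS I, I.1, I.2, rfl⟩, ?_⟩
    refine LinearMap.ext fun G => LinearMap.ext fun F => ?_
    rw [hc G F]
    simp only [LinearMap.comp_apply, Finsupp.sum, LinearMap.sum_apply]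
    rfl
  · rintro ⟨T, hT, rfl⟩
    suffices h : ∃ c : (ℕ × ℕ) × (ℕ × ℕ) →₀ SFun, (∀ I, c I ∈ S) ∧
        ∀ G F, T G F = c.sum fun I a => mulL (mulL a (ηpow I.1 G)) (ηpow I.2 F) by
      obtain ⟨c, hc, h⟩ := h
      exact ⟨c, fun G F => h G.1 F, hc⟩
    induction hT using Submodule.span_induction with
    | mem A h =>
      obtain ⟨b, hb, I, J, rfl⟩ := h
      refine ⟨Finsupp.single (I, J) b, fun K => ?_, fun G F => ?_⟩
      · rw [Finsupp.single_apply]; split_ifs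
        · exact hb
        · exact zero_mem _
      · rw [Finsupp.sum_single_index (by simp)]; rfl
    | zero => exact ⟨0, fun _ => zero_mem _, fun G F => by simp⟩
    | add A B _ _ hA hB =>
      obtain ⟨c, hc, h⟩ := hA
      obtain ⟨c', hc', h'⟩ := hB
      refine ⟨c + c', fun I => add_mem (hc I) (hc' I), fun G F => ?_⟩
      rw [Finsupp.sum_add_index' (by simp) (by simp), ← h, ← h']
      rfl
    | smul r A _ hA =>
      obtain ⟨c, hc, h⟩ := hA
      refine ⟨r • c, fun I => Submodule.smul_mem _ _ (hc I), fun G F => ?_⟩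
      rw [Finsupp.sum_smul_index' (by simp)]
      simp only [map_smul, LinearMap.smul_apply, ← Finsupp.smul_sum, ← h]

end bidiffOps

/-! ### Differential cochains as restrictions of bidifferential operators; coboundaries. -/

/-- An expression already forces the values to be differential operators, so only the expression has
to be tracked. -/
theorem isDiffCochain_iff (Υ : Cochain) :
    IsDiffCochain Υ ↔ ∃ T ∈ bidiffOps ⊤, Υ = T ∘ₗ osp22.subtype := by
  rw [← exists_expression_iff]
  constructor
  · rintro ⟨-, c, hc⟩; exact ⟨c, hc, fun _ => trivial⟩
  · intro h
    refine ⟨fun G => ?_, h.imp fun _ h => h.1⟩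
    obtain ⟨T, hT, rfl⟩ := (exists_expression_iff Υ).1 h
    exact mem_diffOp_iff.2 (bidiffOps_apply_mem hT _)

theorem hasConstantCoefficients_iff (Υ : Cochain) :
    HasConstantCoefficients Υ ↔
      ∃ T ∈ bidiffOps (LinearMap.ker dx), Υ = T ∘ₗ osp22.subtype :=
  exists_expression_iff (S := LinearMap.ker dx) Υ

theorem lieDer_mem_bidiffOps (lam : ℝ) : lieDer lam ∈ bidiffOps ⊤ := by
  have hT := isCoeffSpace_top
  have h : lieDer lam = prodOp 1 dx - (1 / 2 : ℝ) • ∑ p : ZMod 2, (-1 : ℝ) ^ p.val •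
      (prodOp (η₁ * part p) η₁ + prodOp (η₂ * part p) η₂) + lam • prodOp dx 1 := by
    refine LinearMap.ext fun G => ?_
    simp only [LinearMap.add_apply, LinearMap.sub_apply, LinearMap.smul_apply,
      LinearMap.sum_apply, prodOp_apply, mul_one]
    rfl
  rw [h]
  refine add_mem (sub_mem (prodOp_mem hT (one_mem _) dx_mem_ops) (Submodule.smul_mem _ _
    (sum_mem fun p _ => Submodule.smul_mem _ _ (add_mem ?_ ?_))))
    (Submodule.smul_mem _ _ (prodOp_mem hT dx_mem_ops (one_mem _)))
  · exact prodOp_mem hT (mul_mem η₁_mem_ops (part_mem_ops hT p)) η₁_mem_ops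
  · exact prodOp_mem hT (mul_mem η₂_mem_ops (part_mem_ops hT p)) η₂_mem_ops

theorem act_flip_mem_bidiffOps (lam mu : ℝ) {A : Module.End ℝ SFun} (hA : A ∈ diffOp) :
    (act lam mu).flip A ∈ bidiffOps ⊤ := by
  have hT := isCoeffSpace_top
  have h : (act lam mu).flip A = ∑ p : ZMod 2, ∑ q : ZMod 2,
      (LinearMap.mulRight ℝ (opPart q A) ∘ₗ (lieDer mu ∘ₗ part p)
        - (-1 : ℝ) ^ (p.val * q.val) • (opPart q A • (lieDer lam ∘ₗ part p))) := by
    refine LinearMap.ext fun G => ?_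
    simp only [LinearMap.sum_apply]
    rfl
  have hA' : ∀ q, opPart q A ∈ ops (⊤ : Submodule ℝ SFun) :=
    fun q => opPart_mem_ops hT q (mem_diffOp_iff.1 hA)
  have hL : ∀ (nu : ℝ) p, lieDer nu ∘ₗ part p ∈ bidiffOps ⊤ :=
    fun nu p => bidiffOps_comp_left hT (part_mem_ops hT p) (lieDer_mem_bidiffOps nu)
  rw [h]
  refine sum_mem fun p _ => sum_mem fun q _ => sub_mem ?_ (Submodule.smul_mem _ _ ?_)
  · exact bidiffOps_mul_right hT (hA' q) (hL mu p)
  · exact bidiffOps_smul hT (hA' q) (hL lam p)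

theorem isDiffCochain_delta₀ (lam mu : ℝ) {A : Module.End ℝ SFun} (hA : A ∈ diffOp) :
    IsDiffCochain (delta₀ lam mu A) := by
  have hT := isCoeffSpace_top
  refine (isDiffCochain_iff _).2 ⟨∑ p : ZMod 2, ∑ q : ZMod 2, (-1 : ℝ) ^ (p.val * q.val) •
    ((act lam mu).flip (opPart q A) ∘ₗ part p), ?_, ?_⟩
  · exact sum_mem fun p _ => sum_mem fun q _ => Submodule.smul_mem _ _
      (bidiffOps_comp_left hT (part_mem_ops hT p) (act_flip_mem_bidiffOps lam mu
        (mem_diffOp_iff.2 (opPart_mem_ops hT q (mem_diffOp_iff.1 hA)))))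
  · have hp : ∀ p, osp22.subtype ∘ₗ ospPart p = part p ∘ₗ osp22.subtype := fun _ => rfl
    refine LinearMap.ext fun G => ?_
    simp only [delta₀, hp, LinearMap.sum_apply, LinearMap.comp_apply, LinearMap.smul_apply]

theorem IsDiffCochain.sub {Υ Υ' : Cochain} (h : IsDiffCochain Υ) (h' : IsDiffCochain Υ') :
    IsDiffCochain (Υ - Υ') := by
  rw [isDiffCochain_iff] at *
  obtain ⟨T, hT, rfl⟩ := h
  obtain ⟨T', hT', rfl⟩ := h'
  exact ⟨T - T', sub_mem hT hT', (LinearMap.sub_comp _ _ _).symm⟩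

/-! ### Parity of operators. -/

theorem part_comp_part (p q : ZMod 2) : part p * part q = if p = q then part q else 0 := by
  refine LinearMap.ext fun F => ?_
  change part p (part q F) = _
  fin_cases p <;> fin_cases q <;> rfl

theorem sum_part : ∑ p : ZMod 2, part p = 1 := by
  rw [sum_parity]
  refine LinearMap.ext fun F => ?_
  change part 0 F + part 1 F = F
  rw [part_zero, part_one]
  ext1 <;> simp

/-- `A` is homogeneous of parity `q`. -/
def HasParity (q : ZMod 2) (A : Module.End ℝ SFun) : Prop :=
  ∀ s, part (s + q) * A = A * part s

theorem HasParity.mul {p q : ZMod 2} {A B : Module.End ℝ SFun} (hA : HasParity p A)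
    (hB : HasParity q B) : HasParity (p + q) (A * B) := fun s => by
  rw [add_comm p q, ← add_assoc, ← mul_assoc, hA, mul_assoc, hB, mul_assoc]

theorem HasParity.sub {q : ZMod 2} {A B : Module.End ℝ SFun} (hA : HasParity q A)
    (hB : HasParity q B) : HasParity q (A - B) := fun s => by
  rw [mul_sub, sub_mul, hA, hB]

theorem HasParity.smul {q : ZMod 2} {A : Module.End ℝ SFun} (hA : HasParity q A) (c : ℝ) :
    HasParity q (c • A) := fun s => by
  rw [mul_smul_comm, smul_mul_assoc, hA]

theorem opPart_eq (q : ZMod 2) (A : Module.End ℝ SFun) :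
    opPart q A = ∑ s : ZMod 2, part (s + q) * A * part s := rfl

theorem hasParity_opPart (q : ZMod 2) (A : Module.End ℝ SFun) : HasParity q (opPart q A) := by
  intro s
  rw [opPart_eq, Finset.mul_sum, Finset.sum_mul]
  refine Finset.sum_congr rfl fun t _ => ?_
  rw [mul_assoc _ (part t) (part s), part_comp_part, mul_assoc _ A, ← mul_assoc,
    part_comp_part, mul_assoc _ A]
  by_cases h : s = t
  · subst h; simp
  · rw [if_neg (fun h' => h (add_right_cancel h')), if_neg (fun h' => h h'.symm)]; simp

theorem HasParity.opPart_eq {q : ZMod 2} {A : Module.End ℝ SFun} (hA : HasParity q A)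
    (r : ZMod 2) : opPart r A = if r = q then A else 0 := by
  have h : ∀ s, part (s + r) * A * part s = if r = q then A * part s else 0 := fun s => by
    rw [mul_assoc, ← hA s, ← mul_assoc, part_comp_part]
    by_cases h : r = q
    · rw [if_pos (by rw [h]), if_pos h]
    · rw [if_neg (fun h' => h (add_left_cancel h')), if_neg h, zero_mul]
  rw [SuperContact.opPart_eq]
  simp only [h]
  split_ifs
  · rw [← Finset.mul_sum, sum_part, mul_one]
  · simp

theorem sum_opPart (A : Module.End ℝ SFun) : ∑ q : ZMod 2, opPart q A = A := by
  have h : ∀ s : ZMod 2, ∑ q : ZMod 2, part (s + q) = 1 := fun s => by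
    rw [← sum_part]; exact Equiv.sum_comp (Equiv.addLeft s) part
  simp only [opPart_eq]
  rw [Finset.sum_comm]
  simp only [← Finset.sum_mul, h, one_mul]
  rw [← Finset.mul_sum, sum_part, mul_one]

theorem part_of_part_eq {p : ZMod 2} {G : SFun} (hG : part p G = G) (r : ZMod 2) :
    part r G = if r = p then G else 0 := by
  have h := LinearMap.congr_fun (part_comp_part r p) G
  rw [Module.End.mul_apply, hG] at h
  rw [h]
  split_ifs
  · exact hG
  · rfl

/-! ### Lie derivatives form a representation of the contact bracket. -/

theorem lieDer_apply (lam : ℝ) (F H : SFun) :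
    lieDer lam F H = F * dx H - (1 / 2 : ℝ) •
      ((η₁ (part 0 F) * η₁ H + η₂ (part 0 F) * η₂ H)
        - (η₁ (part 1 F) * η₁ H + η₂ (part 1 F) * η₂ H)) + lam • (dx F * H) := by
  have h1 : ZMod.val (1 : ZMod 2) = 1 := rfl
  change F * dx H - (1 / 2 : ℝ) • ((∑ p : ZMod 2, (-1 : ℝ) ^ p.val •
    (mulL (η₁ (part p F)) * η₁ + mulL (η₂ (part p F)) * η₂) : Module.End ℝ SFun) H)
      + lam • (dx F * H) = _
  rw [sum_parity, ZMod.val_zero, h1, pow_zero, pow_one, one_smul, neg_one_smul,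
    ← sub_eq_add_neg]
  rfl

theorem parity_cases (p : ZMod 2) : p = 0 ∨ p = 1 := by revert p; decide

theorem hasParity_lieDer (lam : ℝ) {p : ZMod 2} {G : SFun} (hG : part p G = G) :
    HasParity p (lieDer lam G) := by
  intro s
  refine LinearMap.ext fun H => ?_
  change part (s + p) (lieDer lam G H) = lieDer lam G (part s H)
  have h11 : (1 + 1 : ZMod 2) = 0 := rfl
  rw [← hG]
  rcases parity_cases p with rfl | rfl <;> rcases parity_cases s with rfl | rfl <;>
    simp only [lieDer_apply, zero_add, add_zero, h11, part_zero, part_one, η₁_apply, η₂_apply,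
      dx_apply] <;>
    ext1 <;> simp

theorem part_contactBracket {p q : ZMod 2} {F G : SFun} (hF : part p F = F) (hG : part q G = G) :
    part (p + q) (contactBracket F G) = contactBracket F G := by
  have h11 : (1 + 1 : ZMod 2) = 0 := rfl
  rw [← hF, ← hG]
  rcases parity_cases p with rfl | rfl <;> rcases parity_cases q with rfl | rfl <;>
    simp only [contactBracket_eq, zero_add, add_zero, h11, part_zero, part_one, η₁_apply,
      η₂_apply, dx_apply] <;>
    ext1 <;> simp

/-- Generating functions behave as densities of weight -1, so the coordinate formulas for `lieDer`
also compute brackets. -/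
theorem contactBracket_eq_lieDer (F G : SFun) : contactBracket F G = lieDer (-1) F G := by
  rw [contactBracket_eq, lieDer_apply, neg_one_smul]
  abel

theorem lieDer_even (lam : ℝ) (a b : Smooth) (H : SFun) :
    lieDer lam ⟨a, 0, 0, b⟩ H =
      ⟨a * Smooth.d H.f0 + lam • (Smooth.d a * H.f0),
       a * Smooth.d H.f1 + (1 / 2 : ℝ) • (Smooth.d a * H.f1 + b * H.f2)
        + lam • (Smooth.d a * H.f1),
       a * Smooth.d H.f2 + (1 / 2 : ℝ) • (Smooth.d a * H.f2 - b * H.f1)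
        + lam • (Smooth.d a * H.f2),
       a * Smooth.d H.f12 + Smooth.d a * H.f12 +
        lam • (Smooth.d a * H.f12 + Smooth.d b * H.f0)⟩ := by
  simp only [lieDer_apply, part_zero, part_one, η₁_apply, η₂_apply, dx_apply]
  ext1 <;> simp <;> ext t <;> simp <;> ring

theorem lieDer_odd (lam : ℝ) (u v : Smooth) (H : SFun) :
    lieDer lam ⟨0, u, v, 0⟩ H =
      ⟨(1 / 2 : ℝ) • (u * H.f1 + v * H.f2),
       (1 / 2 : ℝ) • (u * Smooth.d H.f0 - v * H.f12) + lam • (Smooth.d u * H.f0),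
       (1 / 2 : ℝ) • (v * Smooth.d H.f0 + u * H.f12) + lam • (Smooth.d v * H.f0),
       (1 / 2 : ℝ) • (u * Smooth.d H.f2 - v * Smooth.d H.f1 + Smooth.d u * H.f2
        - Smooth.d v * H.f1) + lam • (Smooth.d u * H.f2 - Smooth.d v * H.f1)⟩ := by
  simp only [lieDer_apply, part_zero, part_one, η₁_apply, η₂_apply, dx_apply]
  ext1 <;> simp <;> ext t <;> simp <;> ring

/-- A direct check: in each of the four parity cases both sides become, in coordinates, polynomials
in the coefficients and their derivatives. -/
theorem lieDer_contactBracket (lam : ℝ) {p q : ZMod 2} {F G : SFun} (hF : part p F = F)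
    (hG : part q G = G) :
    lieDer lam (contactBracket F G) = lieDer lam F * lieDer lam G
      - (-1 : ℝ) ^ (p.val * q.val) • (lieDer lam G * lieDer lam F) := by
  have h1 : ZMod.val (1 : ZMod 2) = 1 := rfl
  refine LinearMap.ext fun H => ?_
  change lieDer lam (contactBracket F G) H = lieDer lam F (lieDer lam G H)
      - (-1 : ℝ) ^ (p.val * q.val) • lieDer lam G (lieDer lam F H)
  rw [← hF, ← hG, contactBracket_eq_lieDer]
  rcases parity_cases p with rfl | rfl <;> rcases parity_cases q with rfl | rfl <;>
    simp only [part_zero, part_one, lieDer_even, lieDer_odd, h1, ZMod.val_zero, map_zero,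
      mul_zero, smul_zero, add_zero, sub_self, mul_one, pow_zero, pow_one, one_smul,
      neg_smul] <;>
    ext1 <;>
    simp only [sub_f0, sub_f1, sub_f2, sub_f12, neg_f0, neg_f1, neg_f2, neg_f12, map_add, map_sub, map_neg,
      map_smul, Smooth.d_mul] <;>
    ext t <;>
    simp only [Subalgebra.coe_add, Subalgebra.coe_sub, Subalgebra.coe_mul, Subalgebra.coe_smul,
      Subalgebra.coe_neg, Pi.add_apply, Pi.sub_apply, Pi.mul_apply, Pi.smul_apply, Pi.neg_apply,
      smul_eq_mul] <;>
    ring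

theorem act_eq_sum (lam mu : ℝ) (G : SFun) (A : Module.End ℝ SFun) :
    act lam mu G A = ∑ p : ZMod 2, ∑ q : ZMod 2,
      (lieDer mu (part p G) * opPart q A
        - (-1 : ℝ) ^ (p.val * q.val) • (opPart q A * lieDer lam (part p G))) := rfl

theorem act_of_parity (lam mu : ℝ) {p q : ZMod 2} {G : SFun} {A : Module.End ℝ SFun}
    (hG : part p G = G) (hA : HasParity q A) :
    act lam mu G A =
      lieDer mu G * A - (-1 : ℝ) ^ (p.val * q.val) • (A * lieDer lam G) := by
  rw [act_eq_sum, Finset.sum_eq_single p, Finset.sum_eq_single q, hG, hA.opPart_eq, if_pos rfl]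
  · intro r _ hr
    rw [hA.opPart_eq, if_neg hr]; simp
  · simp
  · intro r _ hr
    rw [part_of_part_eq hG, if_neg hr]; simp
  · simp

theorem hasParity_act (lam mu : ℝ) {p q : ZMod 2} {G : SFun} {A : Module.End ℝ SFun}
    (hG : part p G = G) (hA : HasParity q A) : HasParity (p + q) (act lam mu G A) := by
  rw [act_of_parity lam mu hG hA]
  refine ((hasParity_lieDer mu hG).mul hA).sub (HasParity.smul ?_ _)
  rw [add_comm]
  exact hA.mul (hasParity_lieDer lam hG)

/-! ### The identity δδ = 0. -/

theorem part_ospPart (p : ZMod 2) (G : osp22) : part p (ospPart p G).1 = (ospPart p G).1 := by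
  change (part p * part p) G.1 = part p G.1
  rw [part_comp_part, if_pos rfl]

theorem ospPart_of_part_eq {p : ZMod 2} {G : osp22} (hG : part p G.1 = G.1) (r : ZMod 2) :
    ospPart r G = if r = p then G else 0 := by
  refine Subtype.ext ?_
  change part r G.1 = _
  rw [part_of_part_eq hG]
  split_ifs <;> rfl

theorem delta₀_apply (lam mu : ℝ) (A : Module.End ℝ SFun) (G : osp22) :
    delta₀ lam mu A G = ∑ p : ZMod 2, ∑ q : ZMod 2, (-1 : ℝ) ^ (p.val * q.val) •
      act lam mu (ospPart p G).1 (opPart q A) := by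
  simp only [delta₀, LinearMap.sum_apply, LinearMap.smul_apply, LinearMap.comp_apply,
    LinearMap.flip_apply, Submodule.subtype_apply]

theorem delta₀_of_parity (lam mu : ℝ) (A : Module.End ℝ SFun) {p : ZMod 2} {G : osp22}
    (hG : part p G.1 = G.1) :
    delta₀ lam mu A G = ∑ q : ZMod 2, (-1 : ℝ) ^ (p.val * q.val) •
      act lam mu G.1 (opPart q A) := by
  rw [delta₀_apply, Finset.sum_eq_single p, ospPart_of_part_eq hG, if_pos rfl]
  · intro r _ hr
    rw [ospPart_of_part_eq hG, if_neg hr]; simp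
  · simp

theorem cochainPart_of_parity (r : ZMod 2) (Υ : Cochain) {p : ZMod 2} {G : osp22}
    (hG : part p G.1 = G.1) : cochainPart r Υ G = opPart (p + r) (Υ G) := by
  simp only [cochainPart, LinearMap.sum_apply, LinearMap.comp_apply]
  rw [Finset.sum_eq_single p, ospPart_of_part_eq hG, if_pos rfl]
  · intro s _ hs
    rw [ospPart_of_part_eq hG, if_neg hs]; simp
  · simp

/-- Acting by an element of parity `p` shifts parity by exactly `p`, so `δ` preserves parity and
only the component of `A` of parity `r` contributes. -/
theorem cochainPart_delta₀ (lam mu : ℝ) (r : ZMod 2) (A : Module.End ℝ SFun) {p : ZMod 2}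
    {G : osp22} (hG : part p G.1 = G.1) :
    cochainPart r (delta₀ lam mu A) G =
      (-1 : ℝ) ^ (p.val * r.val) • act lam mu G.1 (opPart r A) := by
  rw [cochainPart_of_parity r _ hG, delta₀_of_parity lam mu A hG, map_sum,
    Finset.sum_eq_single r]
  · rw [map_smul, (hasParity_act lam mu hG (hasParity_opPart r A)).opPart_eq, if_pos rfl]
  · intro s _ hs
    rw [map_smul, (hasParity_act lam mu hG (hasParity_opPart s A)).opPart_eq,
      if_neg fun h => hs (add_left_cancel h).symm, smul_zero]
  · simp

/-- The action of `𝔬𝔰𝔭(2|2)` on operators is a representation. -/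
theorem act_contactBracket (lam mu : ℝ) {p q r : ZMod 2} {F G : SFun} {A : Module.End ℝ SFun}
    (hF : part p F = F) (hG : part q G = G) (hA : HasParity r A) :
    act lam mu (contactBracket F G) A = act lam mu F (act lam mu G A)
      - (-1 : ℝ) ^ (p.val * q.val) • act lam mu G (act lam mu F A) := by
  have h1 : ZMod.val (1 : ZMod 2) = 1 := rfl
  have h11 : (1 + 1 : ZMod 2) = 0 := rfl
  rw [act_of_parity lam mu (part_contactBracket hF hG) hA,
    act_of_parity lam mu hF (hasParity_act lam mu hG hA),
    act_of_parity lam mu hG (hasParity_act lam mu hF hA), act_of_parity lam mu hF hA,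
    act_of_parity lam mu hG hA, lieDer_contactBracket mu hF hG, lieDer_contactBracket lam hF hG]
  -- What remains is an identity with signs in an associative algebra, whatever the four operators
  -- are.
  generalize lieDer mu F = a
  generalize lieDer mu G = b
  generalize lieDer lam F = c
  generalize lieDer lam G = d
  rcases parity_cases p with rfl | rfl <;> rcases parity_cases q with rfl | rfl <;>
    rcases parity_cases r with rfl | rfl <;>
    simp only [zero_add, add_zero, h11, h1, ZMod.val_zero, mul_zero, mul_one, pow_zero, pow_one,
      one_smul, neg_smul] <;>
    noncomm_ring

/-- On homogeneous components, the representation identity expands the bracket term into the two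
iterated actions, which cancel the other two terms once the signs are compared. -/
theorem delta₁_delta₀ (lam mu : ℝ) (A : Module.End ℝ SFun) (G H : osp22) :
    delta₁ lam mu (delta₀ lam mu A) G H = 0 := by
  have h1 : ZMod.val (1 : ZMod 2) = 1 := rfl
  have h11 : (1 + 1 : ZMod 2) = 0 := rfl
  refine Finset.sum_eq_zero fun p _ => Finset.sum_eq_zero fun q _ =>
    Finset.sum_eq_zero fun r _ => ?_
  have hG := part_ospPart p G
  have hH := part_ospPart q H
  have hA := hasParity_opPart r A
  have hGH : part (p + q) (ospBracket (ospPart p G) (ospPart q H)).1 =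
    (ospBracket (ospPart p G) (ospPart q H)).1 := part_contactBracket hG hH
  rw [cochainPart_delta₀ lam mu r A hG, cochainPart_delta₀ lam mu r A hH,
    cochainPart_delta₀ lam mu r A hGH,
    show (ospBracket (ospPart p G) (ospPart q H)).1 = contactBracket _ _ from rfl,
    act_contactBracket lam mu hG hH hA, map_smul, map_smul]
  generalize act lam mu (ospPart p G).1 (act lam mu (ospPart q H).1 (opPart r A)) = a
  generalize act lam mu (ospPart q H).1 (act lam mu (ospPart p G).1 (opPart r A)) = b
  rcases parity_cases p with rfl | rfl <;> rcases parity_cases q with rfl | rfl <;>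
    rcases parity_cases r with rfl | rfl <;>
    simp only [zero_add, add_zero, h11, h1, ZMod.val_zero, mul_zero, zero_mul, mul_one, pow_zero,
      pow_one, one_smul, neg_smul, one_mul, smul_neg, one_add_one_eq_two] <;>
    simp <;> abel

theorem delta₁_sub (lam mu : ℝ) (Υ Υ' : Cochain) (G H : osp22) :
    delta₁ lam mu (Υ - Υ') G H = delta₁ lam mu Υ G H - delta₁ lam mu Υ' G H := by
  have h : ∀ r, cochainPart r (Υ - Υ') = cochainPart r Υ - cochainPart r Υ' := fun r => by
    simp only [cochainPart, LinearMap.sub_comp, LinearMap.comp_sub, Finset.sum_sub_distrib]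
  simp only [delta₁, ← Finset.sum_sub_distrib, h]
  refine Finset.sum_congr rfl fun p _ => Finset.sum_congr rfl fun q _ =>
    Finset.sum_congr rfl fun r _ => ?_
  simp only [LinearMap.sub_apply, map_sub, smul_sub]
  abel

theorem sum_ospPart (G : osp22) : ∑ p : ZMod 2, ospPart p G = G := by
  rw [sum_parity]
  refine Subtype.ext ?_
  have h := LinearMap.congr_fun sum_part G.1
  rw [sum_parity] at h
  exact h

theorem sum_cochainPart (Υ : Cochain) : ∑ r : ZMod 2, cochainPart r Υ = Υ := by
  refine LinearMap.ext fun G => ?_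
  simp only [cochainPart, LinearMap.sum_apply, LinearMap.comp_apply]
  rw [Finset.sum_comm]
  have h : ∀ s : ZMod 2, ∀ B, ∑ r : ZMod 2, opPart (s + r) B = B := fun s B => by
    conv_rhs => rw [← sum_opPart B]
    exact Equiv.sum_comp (Equiv.addLeft s) fun q => opPart q B
  simp only [h]
  rw [← map_sum, sum_ospPart]

/-! ### The action of `X₁` and cocycles vanishing on it. -/

theorem part_X₁ : part 0 X₁.1 = X₁.1 := rfl

/-- The weight drops out because the generating function `1` has zero derivative. -/
theorem lieDer_one (lam : ℝ) : lieDer lam one = dx := by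
  refine LinearMap.ext fun H => ?_
  rw [one, lieDer_even]
  simp [Smooth.d_one, dx_apply]

theorem act_X₁ (lam mu : ℝ) (A : Module.End ℝ SFun) :
    act lam mu X₁.1 A = dx * A - A * dx := by
  conv_lhs => rw [← sum_opPart A, map_sum]
  conv_rhs => rw [← sum_opPart A, Finset.mul_sum, Finset.sum_mul, ← Finset.sum_sub_distrib]
  refine Finset.sum_congr rfl fun q _ => ?_
  rw [act_of_parity lam mu part_X₁ (hasParity_opPart q A)]
  simp [X₁, lieDer_one]

theorem delta₀_X₁ (lam mu : ℝ) (A : Module.End ℝ SFun) :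
    delta₀ lam mu A X₁ = dx * A - A * dx := by
  rw [delta₀_of_parity lam mu A part_X₁, ← act_X₁ lam mu A]
  conv_rhs => rw [← sum_opPart A, map_sum]
  simp

theorem ospBracket_X₁ (G : osp22) : (ospBracket X₁ G).1 = dx G.1 := by
  change contactBracket one G.1 = _
  rw [contactBracket_eq_lieDer, lieDer_one]

/-- A cocycle vanishing on `X₁` is `X₁`-invariant. -/
theorem isX₁Invariant_of_cocycle {lam mu : ℝ} {Υ : Cochain}
    (h : ∀ G H, delta₁ lam mu Υ G H = 0) (h₁ : Υ X₁ = 0) : IsX₁Invariant lam mu Υ := by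
  intro G
  have hX : ∀ p, ospPart p X₁ = if p = 0 then X₁ else 0 := ospPart_of_part_eq part_X₁
  have h' := h X₁ G
  -- Since `X₁` is even, only `p = 0` survives and every sign in front of `X₁ · Υ(G)` is trivial.
  -- The middle term vanishes with `Υ X₁`, leaving `X₁ · Υ(G) - Υ([X₁, G]) = 0`.
  rw [delta₁, Finset.sum_eq_single 0] at h'
  · have hc : ∀ r, cochainPart r Υ X₁ = 0 := fun r => by
      rw [cochainPart_of_parity r Υ part_X₁, h₁, map_zero]
    simp only [hX, if_true, hc, map_zero, smul_zero, sub_zero, ZMod.val_zero, zero_mul, pow_zero,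
      one_smul, Finset.sum_sub_distrib] at h'
    simp only [← map_sum, ← LinearMap.sum_apply, sum_cochainPart] at h'
    rw [LinearMap.sum_apply, sum_ospPart] at h'
    have hb : ∑ q, ospBracket X₁ (ospPart q G) = ospBracket X₁ G := by
      refine Subtype.ext ?_
      rw [AddSubmonoidClass.coe_finsetSum]
      simp only [ospBracket_X₁]
      rw [← map_sum, ← AddSubmonoidClass.coe_finsetSum, sum_ospPart]
    rw [hb] at h'
    exact sub_eq_zero.1 h'
  · intro p _ hp
    have hb : ∀ H, ospBracket 0 H = 0 := fun H => Subtype.ext (by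
      change contactBracket 0 H.1 = 0
      rw [contactBracket_eq_lieDer, map_zero]; rfl)
    simp only [hX, if_neg hp, hb]
    simp
  · simp

/-! ### Primitives, values at a point, and integration of coefficients. -/

theorem Smooth.exists_primitive (a : ℝ) (f : Smooth) :
    ∃ g : Smooth, Smooth.d g = f ∧ g.1 a = 0 := by
  have hf : Continuous f.1 := (show ContDiff ℝ ∞ f.1 from f.2).continuous
  have hd : deriv (fun t => ∫ s in a..t, f.1 s) = f.1 :=
    funext fun t => hf.deriv_integral f.1 a t
  refine ⟨⟨fun t => ∫ s in a..t, f.1 s, ?_⟩, Subtype.ext hd, intervalIntegral.integral_same⟩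
  refine contDiff_infty_iff_deriv.2 ⟨fun t => ?_, ?_⟩
  · exact (hf.integral_hasStrictDerivAt a t).hasDerivAt.differentiableAt
  · rw [hd]; exact f.2

/-- The values at `t` of the coefficients of a superfunction, as a constant superfunction. -/
def freeze (t : ℝ) : Module.End ℝ SFun where
  toFun F := ⟨F.f0.1 t • 1, F.f1.1 t • 1, F.f2.1 t • 1, F.f12.1 t • 1⟩
  map_add' F G := by ext1 <;> simp [add_smul]
  map_smul' c F := by ext1 <;> simp [mul_smul]

theorem freeze_apply (t : ℝ) (F : SFun) :
    freeze t F = ⟨F.f0.1 t • 1, F.f1.1 t • 1, F.f2.1 t • 1, F.f12.1 t • 1⟩ := rfl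

theorem dx_freeze (t : ℝ) (F : SFun) : dx (freeze t F) = 0 := by
  rw [freeze_apply, dx_apply]; ext1 <;> simp [Smooth.d_one]

theorem freeze_mul (t : ℝ) (F G : SFun) : freeze t (F * G) = freeze t F * freeze t G := by
  simp only [freeze_apply]
  ext1 <;> ext s <;> simp <;> ring

theorem freeze_freeze (t : ℝ) (F : SFun) : freeze t (freeze t F) = freeze t F := by
  simp only [freeze_apply]
  ext1 <;> ext s <;> simp

theorem freeze_eq_zero_iff {t : ℝ} {F : SFun} : freeze t F = 0 ↔
    F.f0.1 t = 0 ∧ F.f1.1 t = 0 ∧ F.f2.1 t = 0 ∧ F.f12.1 t = 0 := by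
  have h : ∀ c : ℝ, (c • 1 : Smooth) = 0 ↔ c = 0 := fun c => by simp
  rw [SFun.ext_iff, freeze_apply]
  simp only [zero_f0, zero_f1, zero_f2, zero_f12, h]

theorem eq_zero_of_freeze {F : SFun} (h : ∀ t, freeze t F = 0) : F = 0 := by
  simp only [freeze_eq_zero_iff] at h
  ext1 <;> ext t
  · exact (h t).1
  · exact (h t).2.1
  · exact (h t).2.2.1
  · exact (h t).2.2.2

theorem Smooth.eq_of_d_eq_zero {f : Smooth} (h : Smooth.d f = 0) (s t : ℝ) : f.1 s = f.1 t :=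
  is_const_of_deriv_eq_zero ((contDiff_infty_iff_deriv.1 f.2).1)
    (fun u => congrFun (congrArg Subtype.val h) u) s t

theorem eq_zero_of_dx_eq_zero {t : ℝ} {F : SFun} (h : dx F = 0) (ht : freeze t F = 0) :
    F = 0 := by
  rw [dx_apply, SFun.ext_iff] at h
  refine eq_zero_of_freeze fun s => ?_
  rw [freeze_eq_zero_iff] at ht ⊢
  rwa [Smooth.eq_of_d_eq_zero h.1 s t, Smooth.eq_of_d_eq_zero h.2.1 s t,
    Smooth.eq_of_d_eq_zero h.2.2.1 s t, Smooth.eq_of_d_eq_zero h.2.2.2 s t]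

theorem exists_primitive (t : ℝ) (F : SFun) : ∃ P, dx P = F ∧ freeze t P = 0 := by
  obtain ⟨g0, h0, k0⟩ := Smooth.exists_primitive t F.f0
  obtain ⟨g1, h1, k1⟩ := Smooth.exists_primitive t F.f1
  obtain ⟨g2, h2, k2⟩ := Smooth.exists_primitive t F.f2
  obtain ⟨g3, h3, k3⟩ := Smooth.exists_primitive t F.f12
  exact ⟨⟨g0, g1, g2, g3⟩, SFun.ext h0 h1 h2 h3, freeze_eq_zero_iff.2 ⟨k0, k1, k2, k3⟩⟩

/-- Because `∂_x` commutes with the monomials in `η̄ᵢ`, the commutator sees only the coefficient. -/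
theorem mulL_ηpow_commutator (a : SFun) (I : ℕ × ℕ) :
    dx * (mulL a * ηpow I) - mulL a * ηpow I * dx = mulL (dx a) * ηpow I := by
  rw [← mul_assoc, dx_comp_mulL, add_mul, mul_assoc _ dx, commute_dx_ηpow, ← mul_assoc]
  abel

theorem exists_commutator_eq {B : Module.End ℝ SFun} (hB : B ∈ diffOp) :
    ∃ A ∈ diffOp, dx * A - A * dx = B := by
  induction hB using Submodule.span_induction with
  | mem B h =>
    obtain ⟨⟨a, I⟩, rfl⟩ := h
    obtain ⟨P, hP, -⟩ := exists_primitive 0 a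
    exact ⟨mulL P * ηpow I, Submodule.subset_span ⟨(P, I), rfl⟩, by
      rw [mulL_ηpow_commutator, hP]⟩
  | zero => exact ⟨0, zero_mem _, by simp⟩
  | add B B' _ _ h h' =>
    obtain ⟨A, hA, h⟩ := h
    obtain ⟨A', hA', h'⟩ := h'
    exact ⟨A + A', add_mem hA hA', by rw [← h, ← h', mul_add, add_mul]; abel⟩
  | smul c B _ h =>
    obtain ⟨A, hA, h⟩ := h
    exact ⟨c • A, Submodule.smul_mem _ _ hA, by
      rw [← h, mul_smul_comm, smul_mul_assoc, smul_sub]⟩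

theorem commute_dx_of_mem_ops {B : Module.End ℝ SFun} (hB : B ∈ ops (LinearMap.ker dx)) :
    Commute dx B := by
  induction hB using Algebra.adjoin_induction with
  | mem A h =>
    rcases h with ⟨a, ha, rfl⟩ | rfl | rfl
    · rw [commute_iff_eq, dx_comp_mulL, LinearMap.mem_ker.1 ha, map_zero, zero_add]
    · exact commute_dx_η₁
    · exact commute_dx_η₂
  | algebraMap r => exact Algebra.commute_algebraMap_right r dx
  | add A B _ _ hA hB => exact hA.add_right hB
  | mul A B _ _ hA hB => exact hA.mul_right hB

/-- Freezing the coefficients of `B` at `t` does not change the value of `B F` at `t`. -/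
theorem exists_freeze_eq (t : ℝ) {B : Module.End ℝ SFun} (hB : B ∈ diffOp) :
    ∃ B₀ ∈ ops (LinearMap.ker dx), ∀ F, freeze t (B F) = freeze t (B₀ F) := by
  induction hB using Submodule.span_induction with
  | mem B h =>
    obtain ⟨⟨a, I⟩, rfl⟩ := h
    refine ⟨mulL (freeze t a) * ηpow I, mul_mem (mulL_mem_ops (dx_freeze t a)) (ηpow_mem_ops I),
      fun F => ?_⟩
    change freeze t (a * ηpow I F) = freeze t (freeze t a * ηpow I F)
    rw [freeze_mul, freeze_mul, freeze_freeze]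
  | zero => exact ⟨0, zero_mem _, fun F => rfl⟩
  | add B B' _ _ h h' =>
    obtain ⟨A, hA, h⟩ := h
    obtain ⟨A', hA', h'⟩ := h'
    exact ⟨A + A', add_mem hA hA', fun F => by
      rw [LinearMap.add_apply, LinearMap.add_apply, map_add, map_add, h, h']⟩
  | smul c B _ h =>
    obtain ⟨A, hA, h⟩ := h
    exact ⟨c • A, Subalgebra.smul_mem _ hA c, fun F => by
      rw [LinearMap.smul_apply, LinearMap.smul_apply, map_smul, map_smul, h]⟩

/-! ### Operators commuting with `∂_x`, via Taylor approximation. -/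

/-- The coefficients of `F` vanish to order `n` at `t`. -/
def VanishesToOrder (t : ℝ) : ℕ → SFun → Prop
  | 0, _ => True
  | n + 1, F => freeze t F = 0 ∧ VanishesToOrder t n (dx F)

section VanishesToOrder
variable {t : ℝ}

theorem VanishesToOrder.mono {m n : ℕ} (h : m ≤ n) {F : SFun} (hF : VanishesToOrder t n F) :
    VanishesToOrder t m F := by
  induction m generalizing n F with
  | zero => trivial
  | succ m ih =>
    obtain ⟨n, rfl⟩ := Nat.exists_eq_add_of_le' (Nat.one_le_of_lt h)
    exact ⟨hF.1, ih (Nat.le_of_succ_le_succ h) hF.2⟩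

/-- The components of `η̄₁ F` involve at most one derivative in `x`, so at most one order is lost.
-/
theorem VanishesToOrder.η₁ {n : ℕ} {F : SFun} (hF : VanishesToOrder t (n + 1) F) :
    VanishesToOrder t n (η₁ F) := by
  induction n generalizing F with
  | zero => trivial
  | succ n ih =>
    have h0 := freeze_eq_zero_iff.1 hF.1
    have h1 := freeze_eq_zero_iff.1 hF.2.1
    refine ⟨?_, ?_⟩
    · rw [freeze_eq_zero_iff, η₁_apply]
      simp only [dx_apply] at h1
      exact ⟨h0.2.1, by simp [h1.1], h0.2.2.2, by simp [h1.2.2.1]⟩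
    · rw [show dx (SFun.η₁ F) = SFun.η₁ (dx F) from LinearMap.congr_fun commute_dx_η₁ F]
      exact ih hF.2

theorem VanishesToOrder.η₂ {n : ℕ} {F : SFun} (hF : VanishesToOrder t (n + 1) F) :
    VanishesToOrder t n (η₂ F) := by
  induction n generalizing F with
  | zero => trivial
  | succ n ih =>
    have h0 := freeze_eq_zero_iff.1 hF.1
    have h1 := freeze_eq_zero_iff.1 hF.2.1
    refine ⟨?_, ?_⟩
    · rw [freeze_eq_zero_iff, η₂_apply]
      simp only [dx_apply] at h1
      exact ⟨h0.2.2.1, by simp [h0.2.2.2], by simp [h1.1], h1.2.1⟩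
    · rw [show dx (SFun.η₂ F) = SFun.η₂ (dx F) from LinearMap.congr_fun commute_dx_η₂ F]
      exact ih hF.2

theorem VanishesToOrder.η₁_pow {m n : ℕ} {F : SFun} (hF : VanishesToOrder t (n + m) F) :
    VanishesToOrder t n ((SFun.η₁ ^ m) F) := by
  induction m generalizing n with
  | zero => exact hF
  | succ m ih =>
    rw [pow_succ', Module.End.mul_apply]
    exact (ih (by rwa [add_assoc, add_comm 1 m])).η₁

theorem VanishesToOrder.η₂_pow {m n : ℕ} {F : SFun} (hF : VanishesToOrder t (n + m) F) :
    VanishesToOrder t n ((SFun.η₂ ^ m) F) := by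
  induction m generalizing n with
  | zero => exact hF
  | succ m ih =>
    rw [pow_succ', Module.End.mul_apply]
    exact (ih (by rwa [add_assoc, add_comm 1 m])).η₂

end VanishesToOrder

theorem exists_order {B : Module.End ℝ SFun} (hB : B ∈ diffOp) :
    ∃ n, ∀ t F, VanishesToOrder t n F → freeze t (B F) = 0 := by
  induction hB using Submodule.span_induction with
  | mem B h =>
    obtain ⟨⟨a, I⟩, rfl⟩ := h
    -- Each factor `η̄ᵢ` costs one order, and one more is needed for the value at `t` to vanish.
    refine ⟨1 + I.1 + I.2, fun t F hF => ?_⟩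
    have h : freeze t (ηpow I F) = 0 := hF.η₂_pow.η₁_pow.1
    change freeze t (a * ηpow I F) = 0
    rw [freeze_mul, h]
    ext1 <;> simp
  | zero => exact ⟨0, fun t F _ => map_zero _⟩
  | add B B' _ _ h h' =>
    obtain ⟨n, h⟩ := h
    obtain ⟨n', h'⟩ := h'
    refine ⟨max n n', fun t F hF => ?_⟩
    rw [LinearMap.add_apply, map_add, h t F (hF.mono (le_max_left _ _)),
      h' t F (hF.mono (le_max_right _ _)), add_zero]
  | smul c B _ h =>
    obtain ⟨n, h⟩ := h
    refine ⟨n, fun t F hF => ?_⟩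
    rw [LinearMap.smul_apply, map_smul, h t F hF, smul_zero]

/-- This is Taylor's polynomial: integrate from `t` an approximation of `F'` and add the constant
term `freeze t F`. Being killed by a power of `dx` stands for having polynomial coefficients. -/
theorem exists_dx_nilpotent_approx (t : ℝ) (n : ℕ) (F : SFun) :
    ∃ P m, (dx ^ m) P = 0 ∧ VanishesToOrder t n (F - P) := by
  induction n generalizing F with
  | zero => exact ⟨0, 0, rfl, trivial⟩
  | succ n ih =>
    obtain ⟨P, m, hP, h⟩ := ih (dx F)
    obtain ⟨Q, hQ, hQt⟩ := exists_primitive t P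
    have hd : dx (Q + freeze t F) = P := by rw [map_add, hQ, dx_freeze, add_zero]
    refine ⟨Q + freeze t F, m + 1, ?_, ?_, ?_⟩
    · rw [pow_succ, Module.End.mul_apply, hd, hP]
    · rw [map_sub, map_add, hQt, freeze_freeze, zero_add, sub_self]
    · rwa [map_sub, hd]

/-- By induction on the degree, `(C F)' = C (F')` is zero, so `C F` is constant in `x`; and it
vanishes at `t`. -/
theorem apply_eq_zero_of_dx_nilpotent {t : ℝ} {C : Module.End ℝ SFun} (hC : Commute dx C)
    (h : ∀ F, freeze t (C F) = 0) (n : ℕ) {F : SFun} (hF : (dx ^ n) F = 0) : C F = 0 := by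
  induction n generalizing F with
  | zero => rw [show F = 0 from hF, map_zero]
  | succ n ih =>
    rw [pow_succ, Module.End.mul_apply] at hF
    refine eq_zero_of_dx_eq_zero (t := t) ?_ (h F)
    rw [← ih hF]
    exact LinearMap.congr_fun hC F

/-- The value of `C F` at any point `s` depends only on a finite jet of `F` there, so `F` may be
replaced by its Taylor polynomial at `s`, which `C` kills. -/
theorem eq_zero_of_commute_dx {t : ℝ} {C : Module.End ℝ SFun} (hD : C ∈ diffOp)
    (hC : Commute dx C) (h : ∀ F, freeze t (C F) = 0) : C = 0 := by
  obtain ⟨n, hn⟩ := exists_order hD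
  refine LinearMap.ext fun F => eq_zero_of_freeze fun s => ?_
  obtain ⟨P, m, hP, hFP⟩ := exists_dx_nilpotent_approx s n F
  rw [← hn s _ hFP, map_sub, apply_eq_zero_of_dx_nilpotent hC h m hP, sub_zero]

/-- The differential operators commuting with `∂_x` are those with constant coefficients. -/
theorem mem_ops_ker_dx_of_commute {B : Module.End ℝ SFun} (hD : B ∈ diffOp)
    (hB : Commute dx B) : B ∈ ops (LinearMap.ker dx) := by
  obtain ⟨B₀, h₀, h⟩ := exists_freeze_eq 0 hD
  have hz : B - B₀ = 0 := eq_zero_of_commute_dx (t := 0)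
    (sub_mem hD (mem_diffOp_iff.2 (ops_mono le_top h₀)))
    (hB.sub_right (commute_dx_of_mem_ops h₀))
    (fun F => by rw [LinearMap.sub_apply, map_sub, h, sub_self])
  rwa [sub_eq_zero.1 hz]

/-! ### Invariance under `X₁` versus constant coefficients. -/

theorem bidiffOps_dx {T : SFun →ₗ[ℝ] Module.End ℝ SFun}
    (hT : T ∈ bidiffOps (LinearMap.ker dx)) (G : SFun) :
    dx * T G - T G * dx = T (dx G) := by
  refine bidiffOps_induction (p := fun T => dx * T G - T G * dx = T (dx G))
    (fun P hP Q hQ => ?_) (by simp) (fun T T' h h' => ?_) (fun c T h => ?_) hT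
  · have hPG : dx (P G) = P (dx G) := LinearMap.congr_fun (commute_dx_of_mem_ops hP) G
    rw [prodOp_apply, prodOp_apply, ← hPG, ← mul_assoc, dx_comp_mulL, add_mul, mul_assoc _ dx,
      commute_dx_of_mem_ops hQ, mul_assoc _ Q]
    abel
  · rw [LinearMap.add_apply, LinearMap.add_apply, ← h, ← h', mul_add, add_mul]; abel
  · rw [LinearMap.smul_apply, LinearMap.smul_apply, ← h, mul_smul_comm, smul_mul_assoc, smul_sub]

theorem isX₁Invariant_of_hasConstantCoefficients (lam mu : ℝ) {Υ : Cochain}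
    (h : HasConstantCoefficients Υ) : IsX₁Invariant lam mu Υ := by
  obtain ⟨T, hT, rfl⟩ := (hasConstantCoefficients_iff Υ).1 h
  intro G
  rw [act_X₁]
  change dx * T G.1 - T G.1 * dx = T (ospBracket X₁ G).1
  rw [ospBracket_X₁, bidiffOps_dx hT]

/-- Multiplication by a function of `x`. -/
def mulEven : Smooth →ₗ[ℝ] Module.End ℝ SFun where
  toFun f := mulL ⟨f, 0, 0, 0⟩
  map_add' f g := by rw [← map_add]; congr 1; ext1 <;> simp
  map_smul' c f := by rw [RingHom.id_apply, ← map_smul]; congr 1; ext1 <;> simp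

theorem mulEven_one : mulEven 1 = 1 := mulL_one

theorem mulEven_mul (f g : Smooth) : mulEven (f * g) = mulEven f * mulEven g := by
  change mulL _ = mulL _ * mulL _
  rw [← mulL_mul]
  congr 1
  ext1 <;> simp

theorem mulEven_x_mem : mulEven Smooth.x ∈ ops (⊤ : Submodule ℝ SFun) := mulL_mem_ops trivial

theorem dx_comp_mulEven (f : Smooth) :
    dx * mulEven f = mulEven (Smooth.d f) + mulEven f * dx := by
  change dx * mulL _ = mulL _ + mulL _ * dx
  rw [dx_comp_mulL]
  congr 2
  rw [dx_apply]; ext1 <;> simp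

/-- An invariant `Υ` is reconstructed from finitely many operators commuting with `∂_x`: the
operator coefficients of `G` and its `x`-derivatives in `Υ(X_G)`. Components of elements of `osp22`
have degree at most 2 in `x`, so no higher derivative occurs. -/
theorem hasConstantCoefficients_of_isX₁Invariant {lam mu : ℝ} {Υ : Cochain}
    (hΥ : ∀ G, Υ G ∈ diffOp) (h : IsX₁Invariant lam mu Υ) : HasConstantCoefficients Υ := by
  have hK := isCoeffSpace_ker_dx
  -- Since `[X₁, X_G]` has generating function `G'`, invariance says `[∂_x, Υ(X_G)] = Υ(X_{G'})`.
  have hD : ∀ G G' : osp22, dx G.1 = G'.1 → dx * Υ G = Υ G' + Υ G * dx := fun G G' hG => by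
    have h' := h G
    rw [act_X₁, show ospBracket X₁ G = G' from Subtype.ext ((ospBracket_X₁ G).trans hG)] at h'
    rw [← h', sub_add_cancel]
  have hops : ∀ G, Υ G ∈ ops (⊤ : Submodule ℝ SFun) := fun G => mem_diffOp_iff.1 (hΥ G)
  have mem : ∀ F ∈ ({one, x, x * x, x * θ₁, x * θ₂, θ₁, θ₂, θ₁ * θ₂} : Set SFun), F ∈ osp22 :=
    fun F hF => Submodule.subset_span hF
  let ex : osp22 := ⟨x, mem _ (by simp)⟩
  let exx : osp22 := ⟨x * x, mem _ (by simp)⟩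
  let e₁ : osp22 := ⟨θ₁, mem _ (by simp)⟩
  let e₂ : osp22 := ⟨θ₂, mem _ (by simp)⟩
  let ex₁ : osp22 := ⟨x * θ₁, mem _ (by simp)⟩
  let ex₂ : osp22 := ⟨x * θ₂, mem _ (by simp)⟩
  let e₁₂ : osp22 := ⟨θ₁ * θ₂, mem _ (by simp)⟩
  have c1 : dx * Υ X₁ = Υ X₁ * dx := by
    rw [hD X₁ 0 (by simp [X₁, one, dx_apply, Smooth.d_one]; rfl), map_zero, zero_add]
  have cx : dx * Υ ex = Υ X₁ + Υ ex * dx :=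
    hD _ _ (by simp [ex, X₁, x, one, dx_apply, Smooth.d_x])
  have cxx : dx * Υ exx = (2 : ℝ) • Υ ex + Υ exx * dx := by
    rw [hD exx ((2 : ℝ) • ex) ?_, map_smul]
    simp only [exx, ex, x, dx_apply, Submodule.coe_smul]
    ext1 <;> simp [Smooth.d_mul, Smooth.d_x, two_smul]
  have ce₁ : dx * Υ e₁ = Υ e₁ * dx := by
    rw [hD e₁ 0 (by simp [e₁, θ₁, dx_apply, Smooth.d_one]; rfl), map_zero, zero_add]
  have ce₂ : dx * Υ e₂ = Υ e₂ * dx := by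
    rw [hD e₂ 0 (by simp [e₂, θ₂, dx_apply, Smooth.d_one]; rfl), map_zero, zero_add]
  have ce₁₂ : dx * Υ e₁₂ = Υ e₁₂ * dx := by
    rw [hD e₁₂ 0 (by simp [e₁₂, θ₁, θ₂, dx_apply, Smooth.d_one]; rfl), map_zero, zero_add]
  have cx₁ : dx * Υ ex₁ = Υ e₁ + Υ ex₁ * dx :=
    hD _ _ (by simp only [ex₁, e₁, x, θ₁, dx_apply]; ext1 <;> simp [Smooth.d_x])
  have cx₂ : dx * Υ ex₂ = Υ e₂ + Υ ex₂ * dx :=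
    hD _ _ (by simp only [ex₂, e₂, x, θ₂, dx_apply]; ext1 <;> simp [Smooth.d_x])
  set Z := mulEven Smooth.x with hZ
  have hZops : Z ∈ ops (⊤ : Submodule ℝ SFun) := mulEven_x_mem
  have cZ : dx * Z = 1 + Z * dx := by
    rw [hZ, dx_comp_mulEven, Smooth.d_x, mulEven_one]
  have cst : ∀ B ∈ ops (⊤ : Submodule ℝ SFun), dx * B = B * dx → B ∈ ops (LinearMap.ker dx) :=
    fun B hB hc => mem_ops_ker_dx_of_commute (mem_diffOp_iff.2 hB) hc
  -- If `[∂_x, A] = 0` and `[∂_x, B] = A`, then `B - xA` commutes with `∂_x`, because `[∂_x, x] =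
  -- 1`.
  have sub_comm : ∀ A B : Module.End ℝ SFun, dx * A = A * dx → dx * B = A + B * dx →
      dx * (B - Z * A) = (B - Z * A) * dx := fun A B hA hB => by
    rw [mul_sub, sub_mul, ← mul_assoc, cZ, add_mul, hB, mul_assoc Z dx, hA, one_mul, mul_assoc]
    abel
  have hB1 := cst _ (hops X₁) c1
  have hBx := cst (Υ ex - Z * Υ X₁) (sub_mem (hops _) (mul_mem hZops (hops _)))
    (sub_comm _ _ c1 cx)
  -- This is `½(Υ(x²) - 2xΥ(x) + x²Υ(1))`; the factor ½ compensates `(x²)'' = 2`.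
  have hBxx := cst ((1 / 2 : ℝ) • (Υ exx - Z * Υ ex - Z * (Υ ex - Z * Υ X₁)))
    (Subalgebra.smul_mem _ (sub_mem (sub_mem (hops _) (mul_mem hZops (hops _)))
      (mul_mem hZops (sub_mem (hops _) (mul_mem hZops (hops _))))) _) (by
    have hx := sub_comm _ _ c1 cx
    rw [mul_smul_comm, smul_mul_assoc, mul_sub, sub_mul, ← mul_assoc dx Z, cZ, add_mul,
      mul_assoc Z dx, hx, mul_sub dx, sub_mul _ _ dx, cxx, ← mul_assoc dx Z, cZ, add_mul,
      mul_assoc Z dx, cx, two_smul]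
    congr 1
    noncomm_ring)
  have hBe₁ := cst _ (hops e₁) ce₁
  have hBe₂ := cst _ (hops e₂) ce₂
  have hBe₁₂ := cst _ (hops e₁₂) ce₁₂
  have hBx₁ := cst (Υ ex₁ - Z * Υ e₁) (sub_mem (hops _) (mul_mem hZops (hops _)))
    (sub_comm _ _ ce₁ cx₁)
  have hBx₂ := cst (Υ ex₂ - Z * Υ e₂) (sub_mem (hops _) (mul_mem hZops (hops _)))
    (sub_comm _ _ ce₂ cx₂)
  have hb := body_mem_ops hK
  have hd₁ := d₁_mem_ops hK
  have hd₂ := d₂_mem_ops hK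
  have hdx : dx ∈ ops (LinearMap.ker dx) := dx_mem_ops
  -- The left factors extract the components of `G` and their derivatives. The last one carries a
  -- minus sign because `∂₁∂₂(θ₁θ₂) = -1`.
  let T : SFun →ₗ[ℝ] Module.End ℝ SFun :=
    prodOp body (Υ X₁) + prodOp (body * dx) (Υ ex - Z * Υ X₁)
      + prodOp (body * (dx * dx)) ((1 / 2 : ℝ) • (Υ exx - Z * Υ ex - Z * (Υ ex - Z * Υ X₁)))
      + prodOp (body * d₁) (Υ e₁) + prodOp (body * (d₁ * dx)) (Υ ex₁ - Z * Υ e₁)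
      + prodOp (body * d₂) (Υ e₂) + prodOp (body * (d₂ * dx)) (Υ ex₂ - Z * Υ e₂)
      + prodOp (-(body * (d₁ * d₂))) (Υ e₁₂)
  have hT : ∀ G : SFun, T G = mulEven G.f0 * Υ X₁
      + mulEven (Smooth.d G.f0) * (Υ ex - Z * Υ X₁)
      + mulEven (Smooth.d (Smooth.d G.f0)) *
        ((1 / 2 : ℝ) • (Υ exx - Z * Υ ex - Z * (Υ ex - Z * Υ X₁)))
      + mulEven G.f1 * Υ e₁ + mulEven (Smooth.d G.f1) * (Υ ex₁ - Z * Υ e₁)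
      + mulEven G.f2 * Υ e₂ + mulEven (Smooth.d G.f2) * (Υ ex₂ - Z * Υ e₂)
      + mulEven G.f12 * Υ e₁₂ := fun G => by
    have hb12 : (-(body * (d₁ * d₂))) G = ⟨G.f12, 0, 0, 0⟩ := by
      change -(body (d₁ (d₂ G))) = _
      rw [body_apply, d₁_apply, d₂_apply]; ext1 <;> simp
    simp only [T, LinearMap.add_apply, prodOp_apply, hb12]
    simp only [Module.End.mul_apply, body_apply, d₁_apply, d₂_apply, dx_apply]
    rfl
  refine (hasConstantCoefficients_iff Υ).2 ⟨T, ?_, ?_⟩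
  · refine add_mem (add_mem (add_mem (add_mem (add_mem (add_mem (add_mem ?_ ?_) ?_) ?_) ?_)
      ?_) ?_) ?_
    · exact prodOp_mem hK hb hB1
    · exact prodOp_mem hK (mul_mem hb hdx) hBx
    · exact prodOp_mem hK (mul_mem hb (mul_mem hdx hdx)) hBxx
    · exact prodOp_mem hK (mul_mem hb hd₁) hBe₁
    · exact prodOp_mem hK (mul_mem hb (mul_mem hd₁ hdx)) hBx₁
    · exact prodOp_mem hK (mul_mem hb hd₂) hBe₂
    · exact prodOp_mem hK (mul_mem hb (mul_mem hd₂ hdx)) hBx₂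
    · exact prodOp_mem hK (neg_mem (mul_mem hb (mul_mem hd₁ hd₂))) hBe₁₂
  -- By linearity the eight generators suffice; on each, the multiples of `x` subtracted above are
  -- restored by the lower-order terms of `T`.
  · have key : ∀ (F : SFun) (hF : F ∈ osp22), Υ ⟨F, hF⟩ = T F := fun F hF => by
      induction hF using Submodule.span_induction with
      | mem F hF =>
        rcases hF with rfl | rfl | rfl | rfl | rfl | rfl | rfl | rfl
        · change Υ X₁ = _
          rw [hT]
          simp [one, Smooth.d_one, mulEven_one]
        · change Υ ex = _
          rw [hT]
          simp [x, Smooth.d_one, Smooth.d_x, mulEven_one, ← hZ]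
        · change Υ exx = _
          rw [hT]
          simp only [x, mul_f0, mul_f1, mul_f2, mul_f12, Smooth.d_mul, Smooth.d_x, mulEven_mul,
            mulEven_one, map_add, ← hZ, mul_zero, zero_mul, add_zero, sub_zero, map_zero, one_mul,
            mul_one, add_mul, ← add_smul]
          norm_num
          noncomm_ring
        · change Υ ex₁ = _
          rw [hT]
          simp [x, θ₁, Smooth.d_x, mulEven_one, ← hZ]
        · change Υ ex₂ = _
          rw [hT]
          simp [x, θ₂, Smooth.d_x, mulEven_one, ← hZ]
        · change Υ e₁ = _
          rw [hT]
          simp [θ₁, Smooth.d_one, mulEven_one]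
        · change Υ e₂ = _
          rw [hT]
          simp [θ₂, Smooth.d_one, mulEven_one]
        · change Υ e₁₂ = _
          rw [hT]
          simp [θ₁, θ₂, mulEven_one]
      | zero => rw [map_zero]; exact map_zero Υ
      | add F F' hF hF' h h' =>
        rw [map_add, ← h, ← h', ← map_add]; rfl
      | smul c F hF h => rw [map_smul, ← h, ← map_smul]; rfl
    exact LinearMap.ext fun G => key G.1 G.2

/-! ### Conclusion. -/

/-- Every differential `1`-cocycle is cohomologous to an `X₁`-invariant one. -/
theorem exists_isX₁Invariant_cohomologous {lam mu : ℝ} {Υ : Cochain}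
    (hΥ : IsDiffCocycle lam mu Υ) :
    ∃ A ∈ diffOp, IsDiffCocycle lam mu (Υ - delta₀ lam mu A) ∧
      IsX₁Invariant lam mu (Υ - delta₀ lam mu A) := by
  -- As `δA(X₁) = [∂_x, A]`, this choice makes `Υ - δA` vanish on `X₁`.
  obtain ⟨A, hA, hAX⟩ := exists_commutator_eq (hΥ.1.1 X₁)
  have hc : IsDiffCocycle lam mu (Υ - delta₀ lam mu A) :=
    ⟨hΥ.1.sub (isDiffCochain_delta₀ lam mu hA), fun G H => by
      rw [delta₁_sub, hΥ.2, delta₁_delta₀, sub_zero]⟩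
  exact ⟨A, hA, hc, isX₁Invariant_of_cocycle hc.2 (by
    rw [LinearMap.sub_apply, delta₀_X₁, hAX, sub_self])⟩

end SuperContact
end

theorem corollary1 (lam mu : ℝ) :
    (∀ Υ : SuperContact.Cochain, SuperContact.IsDiffCocycle lam mu Υ →
      ∃ (Υ' : SuperContact.Cochain) (A : Module.End ℝ SuperContact.SFun),
        SuperContact.IsDiffCocycle lam mu Υ' ∧ A ∈ SuperContact.diffOp ∧
        Υ = Υ' + SuperContact.delta₀ lam mu A ∧
        SuperContact.IsX₁Invariant lam mu Υ' ∧
        SuperContact.HasConstantCoefficients Υ') ∧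
    (∀ Υ : SuperContact.Cochain, SuperContact.IsDiffCochain Υ →
      (SuperContact.IsX₁Invariant lam mu Υ ↔ SuperContact.HasConstantCoefficients Υ)) := by
  refine ⟨fun Υ hΥ => ?_, fun Υ hΥ =>
    ⟨SuperContact.hasConstantCoefficients_of_isX₁Invariant hΥ.1,
      SuperContact.isX₁Invariant_of_hasConstantCoefficients lam mu⟩⟩
  obtain ⟨A, hA, hc, hi⟩ := SuperContact.exists_isX₁Invariant_cohomologous hΥ
  exact ⟨_, A, hc, hA, (sub_add_cancel _ _).symm, hi,
    SuperContact.hasConstantCoefficients_of_isX₁Invariant hc.1.1 hi⟩
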